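/- Let $\mathrm{GF}(q)$ be a finite field with $q\neq 2$, and let $D,N$ be integers with $N>2D\ge 6$. Let $X$ be the set of $D\times(N-D)$ matrices over $\mathrm{GF}(q)$, and let $\Gamma$ be the bilinear forms graph on $X$, in which two matrices are adjacent whenever their difference has rank $1$. Let $\partial$ be the path-length distance of $\Gamma$, put $\Gamma_i(z)=\{w\in X : \partial(z,w)=i\}$ and $\Gamma(z)=\Gamma_1(z)$. Fix adjacent vertices $x,y\in X$. Define the following subsets of $X$: - $O_{i,i-1}=\Gamma_i(x)\cap\Gamma_{i-1}(y)$ and $O_{i-1,i}=\Gamma_{i-1}(x)\cap\Gamma_i(y)$, for $1\le i\le D$; - $O^A_{i,i}$ $(2\le i\le D)$, $O^B_{i,i}$ $(1\le i\le D)$, $O^C_{i,i}$ $(1\le i\le D)$, $O^D_{i,i}$ $(1\le i\le D-1)$, each consisting of the vertices $z\in\Gamma_i(x)\cap\Gamma_i(y)$ for which the pair $$\bigl(\,|\Gamma(x)\cap\Gamma(y)\cap\Gamma_{i-1}(z)|,\ |\Gamma(x)\cap\Gamma(y)\cap\Gamma_{i+1}(z)|\,\bigr)$$ is equal to $(2q^{i-1},\,0)$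 for $O^A_{i,i}$, to $(2q^{i-1}-1,\,0)$ for $O^B_{i,i}$, to $(q^{i-1},\,q^D-q^i)$ for $O^C_{i,i}$, and to $(q^{i-1},\,q^{N-D}-q^i)$ for $O^D_{i,i}$. Then the collection of these $6D-2$ subsets (called the $(x,y)$-partition of $X$) is a partition of $X$ into $6D-2$ distinct nonempty subsets, and this partition is equitable: for any two subsets $S,T$ in the collection, every vertex in $S$ has the same number of neighbours in $T$. -/

import Mathlib

/-- The bilinear forms graph on the `m × n` matrices over `F`: two matrices are adjacent whenever
their difference has rank `1`. -/
def bilinearFormsGraph (F : Type*) [Field F] (m n : ℕ) :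
    SimpleGraph (Matrix (Fin m) (Fin n) F) where
  Adj z w := (z - w).rank = 1
  symm := ⟨fun z w h => by
    have hneg : w - z = (-1 : Matrix (Fin m) (Fin m) F) * (z - w) := by simp
    have hu : IsUnit (-1 : Matrix (Fin m) (Fin m) F).det :=
      (Matrix.isUnit_iff_isUnit_det _).1 isUnit_one.neg
    rw [hneg, Matrix.rank_mul_eq_right_of_isUnit_det _ _ hu]
    exact h⟩
  loopless := ⟨fun z h => by simp at h⟩

namespace SimpleGraph

variable {V : Type*}

/-- `Γ_i(x)`: the vertices at path-length distance `i` from `x`. -/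
def subconstituent (Γ : SimpleGraph V) (i : ℕ) (x : V) : Set V :=
  {z | Γ.dist x z = i}

/-- A partition `P` of the vertex set (into nonempty subsets) is equitable if for all `S, T ∈ P`
the number of neighbours in `T` is the same for all the vertices of `S`. -/
def IsEquitablePartition [Finite V] (Γ : SimpleGraph V) (P : Set (Set V)) : Prop :=
  Setoid.IsPartition P ∧
    ∀ S ∈ P, ∀ T ∈ P, ∃ e : ℕ, ∀ z ∈ S, (Γ.neighborSet z ∩ T).ncard = e

end SimpleGraph

namespace BilinearForms

variable {F : Type*} [Field F] {m n : ℕ}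

/-- `|Γ(x) ∩ Γ(y) ∩ Γ_j(z)|`, for the bilinear forms graph `Γ`. -/
noncomputable def commonCount (x y : Matrix (Fin m) (Fin n) F) (j : ℕ)
    (z : Matrix (Fin m) (Fin n) F) : ℕ :=
  ((bilinearFormsGraph F m n).subconstituent 1 x ∩ (bilinearFormsGraph F m n).subconstituent 1 y ∩
    (bilinearFormsGraph F m n).subconstituent j z).ncard

/-- `Γ_i(x) ∩ Γ_j(y)`. It is the cell `O_{i,i-1}` for `j = i - 1`, and the cell `O_{i-1,i}` for
`(i - 1, i)` in place of `(i, j)`. -/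
def cell (x y : Matrix (Fin m) (Fin n) F) (i j : ℕ) : Set (Matrix (Fin m) (Fin n) F) :=
  (bilinearFormsGraph F m n).subconstituent i x ∩ (bilinearFormsGraph F m n).subconstituent j y

/-- The set of all `z ∈ Γ_i(x) ∩ Γ_i(y)` with `|Γ(x) ∩ Γ(y) ∩ Γ_{i-1}(z)| = r` and
`|Γ(x) ∩ Γ(y) ∩ Γ_{i+1}(z)| = s`. -/
def diagCell (x y : Matrix (Fin m) (Fin n) F) (i r s : ℕ) : Set (Matrix (Fin m) (Fin n) F) :=
  {z | z ∈ cell x y i i ∧ commonCount x y (i - 1) z = r ∧ commonCount x y (i + 1) z = s}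

/-- `O^A_{i,i}`, for `2 ≤ i ≤ m`; here and below `q = |F|`. -/
def cellA (x y : Matrix (Fin m) (Fin n) F) (i : ℕ) : Set (Matrix (Fin m) (Fin n) F) :=
  diagCell x y i (2 * Nat.card F ^ (i - 1)) 0

/-- `O^B_{i,i}`, for `1 ≤ i ≤ m`. -/
def cellB (x y : Matrix (Fin m) (Fin n) F) (i : ℕ) : Set (Matrix (Fin m) (Fin n) F) :=
  diagCell x y i (2 * Nat.card F ^ (i - 1) - 1) 0

/-- `O^C_{i,i}`, for `1 ≤ i ≤ m`; the subtraction does not truncate in this range. -/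
def cellC (x y : Matrix (Fin m) (Fin n) F) (i : ℕ) : Set (Matrix (Fin m) (Fin n) F) :=
  diagCell x y i (Nat.card F ^ (i - 1)) (Nat.card F ^ m - Nat.card F ^ i)

/-- `O^D_{i,i}`, for `1 ≤ i ≤ m - 1`; the subtraction does not truncate when `m < n`. -/
def cellD (x y : Matrix (Fin m) (Fin n) F) (i : ℕ) : Set (Matrix (Fin m) (Fin n) F) :=
  diagCell x y i (Nat.card F ^ (i - 1)) (Nat.card F ^ n - Nat.card F ^ i)

/-- The `(x,y)`-partition of the set of `m × n` matrices (`m` is the diameter of the graph):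
the collection of all the cells `O_{i,i-1}`, `O^A_{i,i}`, `O^B_{i,i}`, `O^C_{i,i}`, `O^D_{i,i}`,
`O_{i-1,i}`, with `i` in the stated ranges. -/
def xyPartition (x y : Matrix (Fin m) (Fin n) F) : Set (Set (Matrix (Fin m) (Fin n) F)) :=
  {S | (∃ i, 1 ≤ i ∧ i ≤ m ∧ S = cell x y i (i - 1)) ∨
    (∃ i, 2 ≤ i ∧ i ≤ m ∧ S = cellA x y i) ∨
    (∃ i, 1 ≤ i ∧ i ≤ m ∧ S = cellB x y i) ∨
    (∃ i, 1 ≤ i ∧ i ≤ m ∧ S = cellC x y i) ∨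
    (∃ i, 1 ≤ i ∧ i ≤ m - 1 ∧ S = cellD x y i) ∨
    (∃ i, 1 ≤ i ∧ i ≤ m ∧ S = cell x y (i - 1) i)}

end BilinearForms

/-! Distance in the graph is the rank of the difference, so after a translation `x = 0` and `y =
vecMulVec u v`. Pairs `(A, B)` of invertible matrices act by `M ↦ A * M * B`, and those with `A *ᵥ u
= u` and `v ᵥ* B = v` fix both `x` and `y`. By `exists_mul_mul_eq` the orbit of `M` is determined by
its rank, by whether `u` lies in the column space and `v` in the row space, and, if both do, by the
value at `(u, v)` of the pairing that `M` induces.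

The rank table `rank_sub_cases`, together with a count of the common neighbours of `x` and `y` (all
of the form `vecMulVec u b` or `vecMulVec a v`), expresses the cells through these invariants. The
pairing value is 1 on O_{i,i-1}, 0 on O^A and anything else on O^B; on O^C only `u` lies in its
space, on O^D only `v`, on O_{i-1,i} neither. So the partition consists of the fibres of `label`
(`xyPartition_eq_image`). Since q ≠ 2 there is a value other than 0 and 1, and O^B is not empty.

Every cell except those of kind B is a single orbit, so its vertices have constant neighbour counts.
O^B becomes one orbit only when `A *ᵥ u = t • u` is allowed. This larger group still preserves all
cells of kinds A, C, D and O_{j-1,j}, but of O_{j,j-1} and O^B_{j,j} only the union. The two are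
separated by a balance argument (`nbrCount_zero_eq_nbrCount_five`): a vertex equidistant from `x`
and `y` has as many neighbours in O_{j,j-1} as in O_{j-1,j}, and the latter count is already known
to be constant. -/

open Module

/-! ### Equivalence of linear maps with a marked vector and a marked functional. -/

section LinearAlgebra

variable {K V W X V' : Type*} [Field K] [AddCommGroup V] [Module K V] [AddCommGroup V']
  [Module K V'] [AddCommGroup W] [Module K W] [AddCommGroup X] [Module K X]

/-- Two linearly independent families with the same index type, in spaces of the same finite
dimension, correspond under a linear equivalence. -/
theorem exists_linearEquiv_apply_eq_of_linearIndependent [FiniteDimensional K V]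
    [FiniteDimensional K V'] (hd : finrank K V = finrank K V') {ι : Type*} {a : ι → V} {a' : ι → V'}
    (ha : LinearIndependent K a) (ha' : LinearIndependent K a') :
    ∃ P : V ≃ₗ[K] V', ∀ i, P (a i) = a' i := by
  classical
  let b := Basis.sumExtend ha
  let b' := Basis.sumExtend ha'
  have : Finite (ι ⊕ Basis.sumExtendIndex ha) := Module.Finite.finite_basis b
  have : Finite (ι ⊕ Basis.sumExtendIndex ha') := Module.Finite.finite_basis b'
  have : Finite ι := Finite.of_injective (Sum.inl : ι → ι ⊕ Basis.sumExtendIndex ha)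
    Sum.inl_injective
  have : Finite (Basis.sumExtendIndex ha) :=
    Finite.of_injective (Sum.inr : _ → ι ⊕ Basis.sumExtendIndex ha) Sum.inr_injective
  have : Finite (Basis.sumExtendIndex ha') :=
    Finite.of_injective (Sum.inr : _ → ι ⊕ Basis.sumExtendIndex ha') Sum.inr_injective
  have h1 := finrank_eq_nat_card_basis b
  have h2 := finrank_eq_nat_card_basis b'
  rw [Nat.card_sum] at h1 h2
  obtain ⟨e⟩ : Nonempty (Basis.sumExtendIndex ha ≃ Basis.sumExtendIndex ha') :=
    Finite.card_eq.1 (by omega)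
  refine ⟨b.equiv b' (Equiv.sumCongr (Equiv.refl ι) e), fun i => ?_⟩
  have hb : b (Sum.inl i) = a i := by simp only [b, Basis.sumExtend, Basis.reindex_apply, Basis.extend_apply_self]; rfl
  have hb' : b' (Sum.inl i) = a' i := by simp only [b', Basis.sumExtend, Basis.reindex_apply, Basis.extend_apply_self]; rfl
  rw [← hb, Basis.equiv_apply, ← hb']
  rfl

theorem exists_linearEquiv_apply_eq [FiniteDimensional K V] [FiniteDimensional K V']
    (hd : finrank K V = finrank K V') {a : V} {a' : V'} (ha : a ≠ 0) (ha' : a' ≠ 0) :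
    ∃ P : V ≃ₗ[K] V', P a = a' := by
  obtain ⟨P, hP⟩ := exists_linearEquiv_apply_eq_of_linearIndependent hd (ι := Unit)
    (a := fun _ => a) (a' := fun _ => a') (linearIndependent_unique_iff.2 ha)
    (linearIndependent_unique_iff.2 ha')
  exact ⟨P, hP ()⟩

/-- A linear equivalence between subspaces extends to the whole space, with prescribed values on a
family that is linearly independent modulo the subspace. -/
theorem exists_linearEquiv_extend [FiniteDimensional K W] {S S' : Submodule K W} (g : S ≃ₗ[K] S')
    {ι : Type*} {t t' : ι → W}
    (ht : LinearIndependent K (Submodule.Quotient.mk (p := S) ∘ t))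
    (ht' : LinearIndependent K (Submodule.Quotient.mk (p := S') ∘ t')) :
    ∃ P : W ≃ₗ[K] W, S.map (P : W →ₗ[K] W) = S' ∧ (∀ s : S, P s = g s) ∧ ∀ i, P (t i) = t' i := by
  let b := Basis.ofVectorSpace K S
  obtain ⟨P, hP⟩ := exists_linearEquiv_apply_eq_of_linearIndependent rfl
    (LinearIndependent.sumElim_of_quotient b.linearIndependent t ht)
    (LinearIndependent.sumElim_of_quotient (b.map g).linearIndependent t' ht')
  have hS : ∀ s : S, P s = g s := by
    intro s
    have : (P : W →ₗ[K] W) ∘ₗ S.subtype = S'.subtype ∘ₗ (g : S →ₗ[K] S') :=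
      b.ext fun i => by simpa using hP (Sum.inl i)
    exact LinearMap.congr_fun this s
  refine ⟨P, ?_, hS, fun i => hP (Sum.inr i)⟩
  ext w
  constructor
  · rintro ⟨s, hs, rfl⟩
    have := hS ⟨s, hs⟩
    simp only [LinearEquiv.coe_coe]
    rw [this]
    exact (g ⟨s, hs⟩).2
  · intro hw
    refine ⟨g.symm ⟨w, hw⟩, (g.symm ⟨w, hw⟩).2, ?_⟩
    simpa using hS (g.symm ⟨w, hw⟩)

/-- Two linear maps with the same range and domains of the same dimension differ by an equivalence
of the domains. -/
theorem exists_linearEquiv_comp_eq_of_range_eq [FiniteDimensional K V] [FiniteDimensional K V']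
    (hd : finrank K V = finrank K V') (f : V →ₗ[K] X) (g : V' →ₗ[K] X)
    (h : LinearMap.range f = LinearMap.range g) : ∃ Q : V ≃ₗ[K] V', ∀ x, g (Q x) = f x := by
  obtain ⟨C, hC⟩ := (LinearMap.ker f).exists_isCompl
  obtain ⟨C', hC'⟩ := (LinearMap.ker g).exists_isCompl
  have h1 := f.finrank_range_add_finrank_ker
  have h2 := g.finrank_range_add_finrank_ker
  rw [h] at h1
  -- Equal ranges force equal nullities, so the kernels can be matched arbitrarily; on the
  -- complements both maps are isomorphisms onto the common range, which dictates `eC`.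
  let eK : LinearMap.ker f ≃ₗ[K] LinearMap.ker g := LinearEquiv.ofFinrankEq _ _ (by omega)
  let eC : C ≃ₗ[K] C' := (f.kerComplementEquivRange hC.symm).trans
    ((LinearEquiv.ofEq _ _ h).trans (g.kerComplementEquivRange hC'.symm).symm)
  let Q := ((Submodule.prodEquivOfIsCompl _ _ hC).symm.trans (eK.prodCongr eC)).trans
    (Submodule.prodEquivOfIsCompl _ _ hC')
  refine ⟨Q, fun x => ?_⟩
  obtain ⟨⟨k, c⟩, rfl⟩ := (Submodule.prodEquivOfIsCompl _ _ hC).surjective x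
  have hc : g (eC c) = f c := by
    have := (g.kerComplementEquivRange hC'.symm).apply_symm_apply
      (LinearEquiv.ofEq _ _ h (f.kerComplementEquivRange hC.symm c))
    exact congrArg Subtype.val this
  have hQ : Q (Submodule.prodEquivOfIsCompl _ _ hC (k, c)) = (eK k : V') + (eC c : V') := by
    simp [Q]
  rw [hQ, map_add, hc, LinearMap.mem_ker.1 (eK k).2]
  simp [LinearMap.mem_ker.1 k.2]

/-- The range of `x ↦ (z x, v x)` consists of the `(s + c • z h, c)` with `s` in `z (ker v)`. The
hypotheses make `P × id` carry one such range onto the other, and `Q` lifts this to the domains. -/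
theorem exists_linearEquiv_of_map_map_ker [FiniteDimensional K V] {z z' : V →ₗ[K] W}
    {v v' : V →ₗ[K] K} (P : W ≃ₗ[K] W) {h h' : V} (hv : v h = 1) (hv' : v' h' = 1)
    (hP : P (z h) = z' h')
    (hS : ((LinearMap.ker v).map z).map (P : W →ₗ[K] W) = (LinearMap.ker v').map z') :
    ∃ Q : V ≃ₗ[K] V, (∀ x, z' (Q x) = P (z x)) ∧ ∀ x, v' (Q x) = v x := by
  obtain ⟨Q, hQ⟩ := exists_linearEquiv_comp_eq_of_range_eq rfl
    (((P : W →ₗ[K] W) ∘ₗ z).prod v) (z'.prod v') (by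
      ext ⟨w, c⟩
      change (∃ x, (P (z x), v x) = (w, c)) ↔ ∃ x, (z' x, v' x) = (w, c)
      simp only [Prod.mk.injEq]
      constructor
      · rintro ⟨x, rfl, rfl⟩
        have : P (z (x - v x • h)) ∈ (LinearMap.ker v').map z' := by
          rw [← hS]
          exact ⟨_, ⟨_, by simp [hv], rfl⟩, rfl⟩
        obtain ⟨k, hk, hk'⟩ := this
        refine ⟨k + v x • h', ?_, ?_⟩
        · rw [map_add, hk', map_smul, ← hP]
          simp
        · simp [LinearMap.mem_ker.1 hk, hv']
      · rintro ⟨x, rfl, rfl⟩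
        have : z' (x - v' x • h') ∈ ((LinearMap.ker v).map z).map (P : W →ₗ[K] W) := by
          rw [hS]
          exact ⟨_, by simp [hv'], rfl⟩
        obtain ⟨_, ⟨k, hk, rfl⟩, hk'⟩ := this
        refine ⟨k + v' x • h, ?_, ?_⟩
        · rw [map_add, map_add, map_smul, map_smul, hP]
          simp only [LinearEquiv.coe_coe] at hk'
          rw [hk']
          simp
        · simp [LinearMap.mem_ker.1 hk, hv])
  refine ⟨Q, fun x => ?_, fun x => ?_⟩
  · exact congrArg Prod.fst (hQ x)
  · exact congrArg Prod.snd (hQ x)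

/-- If some `k` in `ker v` has the same image as `h`, then `h - k` is in `ker z` but not in `ker v`.
This gives the dichotomy behind all rank computations: `z (ker v)` has codimension one in the range
of `z`, or is all of it. -/
theorem apply_mem_map_ker_iff {z : V →ₗ[K] W} {v : V →ₗ[K] K} {h : V} (hv : v h = 1) :
    z h ∈ (LinearMap.ker v).map z ↔ ¬ LinearMap.ker z ≤ LinearMap.ker v := by
  constructor
  · rintro ⟨k, hk, hk'⟩ hle
    have : h - k ∈ LinearMap.ker z := by simp [hk']
    have := hle this
    simp_all
  · intro hle
    obtain ⟨k, hk, hk'⟩ := Set.not_subset.1 hle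
    have hk' : v k ≠ 0 := hk'
    have hk : z k = 0 := hk
    exact ⟨h - (v k)⁻¹ • k, by simp [hv, hk'], by simp [hk]⟩

theorem finrank_sup_span_singleton_of_notMem [FiniteDimensional K W] {S : Submodule K W} {t : W}
    (ht : t ∉ S) : finrank K ↥(S ⊔ Submodule.span K {t}) = finrank K S + 1 := by
  have h := Submodule.finrank_sup_add_finrank_inf_eq S (Submodule.span K {t})
  have ht0 : t ≠ 0 := fun h0 => ht (h0 ▸ S.zero_mem)
  rw [finrank_span_singleton ht0] at h
  have : S ⊓ Submodule.span K {t} = ⊥ :=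
    ((Submodule.disjoint_span_singleton' ht0).2 ht).eq_bot
  rw [this, finrank_bot] at h
  omega

theorem range_eq_map_ker_sup {z : V →ₗ[K] W} {v : V →ₗ[K] K} {h : V} (hv : v h = 1) :
    LinearMap.range z = (LinearMap.ker v).map z ⊔ Submodule.span K {z h} := by
  apply le_antisymm
  · rintro _ ⟨x, rfl⟩
    have : z x = z (x - v x • h) + v x • z h := by simp
    rw [this]
    exact Submodule.add_mem_sup ⟨_, by simp [hv], rfl⟩
      (Submodule.smul_mem _ _ (Submodule.mem_span_singleton_self _))
  · refine sup_le ?_ ?_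
    · rintro _ ⟨k, -, rfl⟩
      exact ⟨k, rfl⟩
    · rw [Submodule.span_singleton_le_iff_mem]
      exact ⟨h, rfl⟩

theorem finrank_range_of_ker_le [FiniteDimensional K W] {z : V →ₗ[K] W} {v : V →ₗ[K] K} {h : V}
    (hv : v h = 1) (hle : LinearMap.ker z ≤ LinearMap.ker v) :
    finrank K (LinearMap.range z) = finrank K ((LinearMap.ker v).map z) + 1 := by
  rw [range_eq_map_ker_sup hv, finrank_sup_span_singleton_of_notMem]
  rw [apply_mem_map_ker_iff hv]
  exact not_not.2 hle

theorem range_eq_map_ker_of_not_ker_le {z : V →ₗ[K] W} {v : V →ₗ[K] K} {h : V}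
    (hv : v h = 1) (hle : ¬ LinearMap.ker z ≤ LinearMap.ker v) :
    LinearMap.range z = (LinearMap.ker v).map z := by
  rw [range_eq_map_ker_sup hv, sup_eq_left, Submodule.span_singleton_le_iff_mem,
    apply_mem_map_ker_iff hv]
  exact hle

theorem linearIndependent_mk_unit {S : Submodule K W} {t : W} (ht : t ∉ S) :
    LinearIndependent K (Submodule.Quotient.mk (p := S) ∘ fun _ : Unit => t) :=
  linearIndependent_unique_iff.2 (by simpa using ht)

theorem exists_apply_eq_one {v : V →ₗ[K] K} (hv : v ≠ 0) : ∃ h, v h = 1 := by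
  obtain ⟨h, hh⟩ : ∃ h, v h ≠ 0 := by
    by_contra hc
    push Not at hc
    exact hv (LinearMap.ext hc)
  exact ⟨(v h)⁻¹ • h, by simp [hh]⟩

theorem exists_mem_ker_apply_eq_one {z : V →ₗ[K] W} {v : V →ₗ[K] K}
    (hle : ¬ LinearMap.ker z ≤ LinearMap.ker v) : ∃ h, z h = 0 ∧ v h = 1 := by
  obtain ⟨k, hk, hk'⟩ := Set.not_subset.1 hle
  have hk' : v k ≠ 0 := hk'
  have hk : z k = 0 := hk
  exact ⟨(v k)⁻¹ • k, by simp [hk], by simp [hk']⟩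

/-- Linear maps `z`, `z'` with marked nonzero vectors `u`, `u'` of the codomain and marked nonzero
functionals `v`, `v'` of the domain are equivalent as soon as their obvious invariants agree. -/
theorem exists_linearEquiv_pair [FiniteDimensional K V] [FiniteDimensional K W]
    {z z' : V →ₗ[K] W} {u u' : W} {v v' : V →ₗ[K] K} (hu : u ≠ 0) (hu' : u' ≠ 0) (hv : v ≠ 0)
    (hv' : v' ≠ 0) (hr : finrank K (LinearMap.range z) = finrank K (LinearMap.range z'))
    (hU : (∃ x, z x = u) ↔ ∃ x, z' x = u')
    (hR : LinearMap.ker z ≤ LinearMap.ker v ↔ LinearMap.ker z' ≤ LinearMap.ker v')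
    (hφ : LinearMap.ker z ≤ LinearMap.ker v → ∀ x x', z x = u → z' x' = u' → v x = v' x') :
    ∃ (P : W ≃ₗ[K] W) (Q : V ≃ₗ[K] V), (∀ x, z' (Q x) = P (z x)) ∧ P u = u' ∧
      ∀ x, v' (Q x) = v x := by
  -- Only `P` and the normalised `h`, `h'` have to be found; `Q` is then a lift.
  suffices H : ∃ (P : W ≃ₗ[K] W) (h h' : V), v h = 1 ∧ v' h' = 1 ∧ P (z h) = z' h' ∧ P u = u' ∧
      ((LinearMap.ker v).map z).map (P : W →ₗ[K] W) = (LinearMap.ker v').map z' by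
    obtain ⟨P, h, h', h1, h2, h3, h4, h5⟩ := H
    obtain ⟨Q, hQ1, hQ2⟩ := exists_linearEquiv_of_map_map_ker P h1 h2 h3 h5
    exact ⟨P, Q, hQ1, h4, hQ2⟩
  by_cases hle : LinearMap.ker z ≤ LinearMap.ker v
  · have hle' := hR.1 hle
    have hd : ∀ {h h'}, v h = 1 → v' h' = 1 → finrank K ((LinearMap.ker v).map z) =
        finrank K ((LinearMap.ker v').map z') := by
      intro h h' h1 h2
      rw [finrank_range_of_ker_le h1 hle, finrank_range_of_ker_le h2 hle'] at hr
      omega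
    obtain ⟨h, hh⟩ := exists_apply_eq_one hv
    obtain ⟨h', hh'⟩ := exists_apply_eq_one hv'
    by_cases hUz : ∃ x, z x = u
    · obtain ⟨x', hx'⟩ := hU.1 hUz
      obtain ⟨x, hx⟩ := hUz
      have hxx := hφ hle x x' hx hx'
      by_cases h0 : v x = 0
      · have h0' : v' x' = 0 := by rw [← hxx, h0]
        have hm : u ∈ (LinearMap.ker v).map z := ⟨x, h0, hx⟩
        have hm' : u' ∈ (LinearMap.ker v').map z' := ⟨x', h0', hx'⟩
        obtain ⟨g, hg⟩ := exists_linearEquiv_apply_eq (hd hh hh')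
          (a := ⟨u, hm⟩) (a' := ⟨u', hm'⟩) (by simpa [Subtype.ext_iff] using hu)
          (by simpa [Subtype.ext_iff] using hu')
        obtain ⟨P, hP1, hP2, hP3⟩ := exists_linearEquiv_extend g
          (linearIndependent_mk_unit (t := z h) (by
            rw [apply_mem_map_ker_iff hh]; exact not_not.2 hle))
          (linearIndependent_mk_unit (t := z' h') (by
            rw [apply_mem_map_ker_iff hh']; exact not_not.2 hle'))
        refine ⟨P, h, h', hh, hh', hP3 (), ?_, hP1⟩
        have := hP2 ⟨u, hm⟩
        rwa [hg] at this
      · have h0' : v' x' ≠ 0 := by rwa [← hxx]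
        have h1 : v ((v x)⁻¹ • x) = 1 := by simp [h0]
        have h1' : v' ((v x)⁻¹ • x') = 1 := by simp [hxx, h0']
        have hz : z ((v x)⁻¹ • x) = (v x)⁻¹ • u := by simp [hx]
        have hz' : z' ((v x)⁻¹ • x') = (v x)⁻¹ • u' := by simp [hx']
        have hn := (not_congr (apply_mem_map_ker_iff h1)).2 (not_not.2 hle)
        have hn' := (not_congr (apply_mem_map_ker_iff h1')).2 (not_not.2 hle')
        rw [hz, Submodule.smul_mem_iff _ (inv_ne_zero h0)] at hn
        rw [hz', Submodule.smul_mem_iff _ (inv_ne_zero h0)] at hn'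
        obtain ⟨P, hP1, -, hP3⟩ := exists_linearEquiv_extend
          (LinearEquiv.ofFinrankEq _ _ (hd hh hh')) (linearIndependent_mk_unit hn)
          (linearIndependent_mk_unit hn')
        refine ⟨P, _, _, h1, h1', ?_, hP3 (), hP1⟩
        rw [hz, hz', map_smul, hP3 ()]
    · have key : ∀ {z : V →ₗ[K] W} {u : W} {v : V →ₗ[K] K} {h : V}, v h = 1 →
          LinearMap.ker z ≤ LinearMap.ker v → (¬ ∃ x, z x = u) →
          LinearIndependent K
            (Submodule.Quotient.mk (p := (LinearMap.ker v).map z) ∘ ![z h, u]) := by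
        intro z u v h hh hle hUz
        have hn := (not_congr (apply_mem_map_ker_iff hh)).2 (not_not.2 hle)
        have : (Submodule.Quotient.mk (p := (LinearMap.ker v).map z) ∘ ![z h, u]) =
            ![Submodule.Quotient.mk (z h), Submodule.Quotient.mk u] := by
          ext i; fin_cases i <;> rfl
        rw [this, LinearIndependent.pair_iff]
        intro a b hab
        rw [← Submodule.Quotient.mk_smul, ← Submodule.Quotient.mk_smul,
          ← Submodule.Quotient.mk_add, Submodule.Quotient.mk_eq_zero] at hab
        have hb : b = 0 := by
          by_contra hb
          obtain ⟨k, -, hk⟩ := hab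
          refine hUz ⟨b⁻¹ • (k - a • h), ?_⟩
          rw [map_smul, map_sub, hk, map_smul, add_sub_cancel_left, smul_smul,
            inv_mul_cancel₀ hb, one_smul]
        subst hb
        refine ⟨?_, rfl⟩
        by_contra ha
        rw [zero_smul, add_zero, Submodule.smul_mem_iff _ ha] at hab
        exact hn hab
      obtain ⟨P, hP1, -, hP3⟩ := exists_linearEquiv_extend
        (LinearEquiv.ofFinrankEq _ _ (hd hh hh')) (key hh hle hUz)
        (key hh' hle' (mt hU.2 hUz))
      exact ⟨P, h, h', hh, hh', hP3 0, hP3 1, hP1⟩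
  · have hle' := mt hR.2 hle
    -- With `h` in the kernel of `z`, the condition on `P (z h)` reduces to `0 = 0`.
    obtain ⟨h, hz, hh⟩ := exists_mem_ker_apply_eq_one hle
    obtain ⟨h', hz', hh'⟩ := exists_mem_ker_apply_eq_one hle'
    have hS := range_eq_map_ker_of_not_ker_le hh hle
    have hS' := range_eq_map_ker_of_not_ker_le hh' hle'
    rw [hS, hS'] at hr
    have hPz : ∀ P : W ≃ₗ[K] W, P (z h) = z' h' := by simp [hz, hz']
    by_cases hUz : ∃ x, z x = u
    · have hm : u ∈ (LinearMap.ker v).map z := by rw [← hS]; exact hUz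
      have hm' : u' ∈ (LinearMap.ker v').map z' := by rw [← hS']; exact hU.1 hUz
      obtain ⟨g, hg⟩ := exists_linearEquiv_apply_eq hr
        (a := ⟨u, hm⟩) (a' := ⟨u', hm'⟩) (by simpa [Subtype.ext_iff] using hu)
        (by simpa [Subtype.ext_iff] using hu')
      obtain ⟨P, hP1, hP2, -⟩ := exists_linearEquiv_extend g (t := Empty.elim)
        (t' := Empty.elim) linearIndependent_empty_type linearIndependent_empty_type
      refine ⟨P, h, h', hh, hh', hPz P, ?_, hP1⟩
      have := hP2 ⟨u, hm⟩
      rwa [hg] at this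
    · have hn : u ∉ (LinearMap.ker v).map z := by rw [← hS]; exact hUz
      have hn' : u' ∉ (LinearMap.ker v').map z' := by rw [← hS']; exact mt hU.2 hUz
      obtain ⟨P, hP1, -, hP3⟩ := exists_linearEquiv_extend (LinearEquiv.ofFinrankEq _ _ hr)
        (linearIndependent_mk_unit hn) (linearIndependent_mk_unit hn')
      exact ⟨P, h, h', hh, hh', hPz P, hP3 (), hP1⟩

/-- The rank of a linear map `w` that differs from `z` by `u ⊗ v`. -/
theorem finrank_range_sub_cases [FiniteDimensional K V] [FiniteDimensional K W]
    {z w : V →ₗ[K] W} {u : W} {v : V →ₗ[K] K} (hv : v ≠ 0) (hw : ∀ x, w x = z x - v x • u) :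
    (LinearMap.ker z ≤ LinearMap.ker v → (∃ x, z x = u ∧ v x = 1) →
      finrank K (LinearMap.range w) + 1 = finrank K (LinearMap.range z)) ∧
    (LinearMap.ker z ≤ LinearMap.ker v → (¬ ∃ x, z x = u ∧ v x = 1) →
      finrank K (LinearMap.range w) = finrank K (LinearMap.range z)) ∧
    (¬ LinearMap.ker z ≤ LinearMap.ker v → (∃ x, z x = u) →
      finrank K (LinearMap.range w) = finrank K (LinearMap.range z)) ∧
    (¬ LinearMap.ker z ≤ LinearMap.ker v → (¬ ∃ x, z x = u) →
      finrank K (LinearMap.range w) = finrank K (LinearMap.range z) + 1) := by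
  obtain ⟨h, hh⟩ := exists_apply_eq_one hv
  -- `w` and `z` agree on `ker v`, so the rank of `w` is decided by whether `w h = z h - u` lies in
  -- the common image of `ker v`.
  have hS : (LinearMap.ker v).map w = (LinearMap.ker v).map z := by
    ext y
    constructor
    · rintro ⟨k, hk, rfl⟩
      exact ⟨k, hk, by simp [hw, LinearMap.mem_ker.1 hk]⟩
    · rintro ⟨k, hk, rfl⟩
      exact ⟨k, hk, by simp [hw, LinearMap.mem_ker.1 hk]⟩
  have hwh : LinearMap.ker w ≤ LinearMap.ker v ↔ z h - u ∉ (LinearMap.ker v).map z := by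
    rw [← not_iff_not, not_not, ← apply_mem_map_ker_iff hh, hS, hw, hh, one_smul]
  have hrw : ∀ {h}, v h = 1 → LinearMap.ker w ≤ LinearMap.ker v →
      finrank K (LinearMap.range w) = finrank K ((LinearMap.ker v).map z) + 1 := by
    intro h hh hle
    rw [finrank_range_of_ker_le hh hle, hS]
  have hrw' : ¬ LinearMap.ker w ≤ LinearMap.ker v →
      finrank K (LinearMap.range w) = finrank K ((LinearMap.ker v).map z) := by
    intro hle
    rw [range_eq_map_ker_of_not_ker_le hh hle, hS]
  have hmem : z h - u ∈ (LinearMap.ker v).map z ↔ ∃ x, z x = u ∧ v x = 1 := by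
    constructor
    · rintro ⟨k, hk, hk'⟩
      exact ⟨h - k, by simp [hk'], by simp [hh, LinearMap.mem_ker.1 hk]⟩
    · rintro ⟨x, rfl, hx⟩
      exact ⟨h - x, by simp [hh, hx], by simp⟩
  refine ⟨fun hle hx => ?_, fun hle hx => ?_, fun hle hx => ?_, fun hle hx => ?_⟩
  · rw [hrw' (by rw [hwh, not_not, hmem]; exact hx), finrank_range_of_ker_le hh hle]
  · rw [hrw hh (by rw [hwh, hmem]; exact hx), finrank_range_of_ker_le hh hle]
  · have hr := range_eq_map_ker_of_not_ker_le hh hle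
    rw [hrw', hr]
    rw [hwh, not_not, ← hr]
    obtain ⟨x, rfl⟩ := hx
    exact ⟨h - x, by simp⟩
  · have hr := range_eq_map_ker_of_not_ker_le hh hle
    rw [hrw hh, hr]
    rw [hwh, ← hr]
    rintro ⟨x, hx'⟩
    exact hx ⟨h - x, by simp [hx']⟩

end LinearAlgebra

/-! ### Row space, column space and the induced pairing; rank-one updates. -/

namespace BilinearForms

open Matrix

variable {F : Type*} [Field F] {m n : ℕ}

/-- The linear functional `x ↦ v ⬝ᵥ x`. -/
def dotLin (v : Fin n → F) : (Fin n → F) →ₗ[F] F where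
  toFun x := v ⬝ᵥ x
  map_add' := dotProduct_add v
  map_smul' c x := dotProduct_smul c v x

@[simp]
theorem dotLin_apply (v x : Fin n → F) : dotLin v x = v ⬝ᵥ x := rfl

theorem dotLin_ne_zero {v : Fin n → F} (hv : v ≠ 0) : dotLin v ≠ 0 := by
  intro h
  exact hv (dotProduct_eq_zero v fun w => LinearMap.congr_fun h w)

/-- The vector `u` lies in the column space of `M`. -/
def InCol (M : Matrix (Fin m) (Fin n) F) (u : Fin m → F) : Prop :=
  ∃ x, M *ᵥ x = u

/-- The vector `v` lies in the row space of `M`, in the form: `v` annihilates the kernel of `M`. -/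
def InRow (M : Matrix (Fin m) (Fin n) F) (v : Fin n → F) : Prop :=
  ∀ x, M *ᵥ x = 0 → v ⬝ᵥ x = 0

/-- For `u` in the column space and `v` in the row space of `M`, the matrix `M` induces a pairing
of `u` and `v`; this says that its value is `c`. -/
def Pairs (M : Matrix (Fin m) (Fin n) F) (u : Fin m → F) (v : Fin n → F) (c : F) : Prop :=
  ∃ x, M *ᵥ x = u ∧ v ⬝ᵥ x = c

theorem Pairs.inCol {M : Matrix (Fin m) (Fin n) F} {u v c} (h : Pairs M u v c) : InCol M u :=
  h.imp fun _ => And.left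

theorem InCol.exists_pairs {M : Matrix (Fin m) (Fin n) F} {u} (h : InCol M u) (v : Fin n → F) :
    ∃ c, Pairs M u v c := by
  obtain ⟨x, hx⟩ := h
  exact ⟨_, x, hx, rfl⟩

theorem InRow.dotProduct_eq {M : Matrix (Fin m) (Fin n) F} {v : Fin n → F} (h : InRow M v)
    {x x' : Fin n → F} (hx : M *ᵥ x = M *ᵥ x') : v ⬝ᵥ x = v ⬝ᵥ x' := by
  have := h (x - x') (by rw [mulVec_sub, hx, sub_self])
  rwa [dotProduct_sub, sub_eq_zero] at this

theorem InRow.pairs_unique {M : Matrix (Fin m) (Fin n) F} {u v c c'} (h : InRow M v)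
    (hc : Pairs M u v c) (hc' : Pairs M u v c') : c = c' := by
  obtain ⟨x, rfl, rfl⟩ := hc
  obtain ⟨x', hx', rfl⟩ := hc'
  exact h.dotProduct_eq hx'.symm

/-- The range of the dual map is the annihilator of the kernel. Thus every statement about columns
has a twin about rows, by transposition. -/
theorem inRow_iff {M : Matrix (Fin m) (Fin n) F} {v : Fin n → F} :
    InRow M v ↔ ∃ y, y ᵥ* M = v := by
  constructor
  · intro h
    have : dotLin v ∈ LinearMap.range M.mulVecLin.dualMap := by
      rw [LinearMap.range_dualMap_eq_dualAnnihilator_ker, Submodule.mem_dualAnnihilator]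
      exact fun x hx => h x hx
    obtain ⟨f, hf⟩ := this
    refine ⟨fun i => f (Pi.single i 1), ?_⟩
    have hfy : ∀ w, f w = (fun i => f (Pi.single i 1)) ⬝ᵥ w := by
      intro w
      conv_lhs => rw [pi_eq_sum_univ' w, map_sum]
      simp only [map_smul, dotProduct, smul_eq_mul]
      refine Finset.sum_congr rfl fun i _ => ?_
      rw [mul_comm]
    apply dotProduct_eq
    intro x
    rw [← dotProduct_mulVec, ← hfy]
    exact LinearMap.congr_fun hf x
  · rintro ⟨y, rfl⟩ x hx
    rw [← dotProduct_mulVec, hx, dotProduct_zero]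

theorem inCol_transpose {M : Matrix (Fin m) (Fin n) F} {v : Fin n → F} :
    InCol Mᵀ v ↔ InRow M v := by
  rw [inRow_iff]
  simp only [InCol, mulVec_transpose]

section RankOneUpdate

variable {M : Matrix (Fin m) (Fin n) F} {u : Fin m → F} {v : Fin n → F}

theorem rank_sub_cases (hv : v ≠ 0) (M : Matrix (Fin m) (Fin n) F) (u : Fin m → F) :
    (InRow M v → Pairs M u v 1 → (M - vecMulVec u v).rank + 1 = M.rank) ∧
    (InRow M v → ¬ Pairs M u v 1 → (M - vecMulVec u v).rank = M.rank) ∧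
    (¬ InRow M v → InCol M u → (M - vecMulVec u v).rank = M.rank) ∧
    (¬ InRow M v → ¬ InCol M u → (M - vecMulVec u v).rank = M.rank + 1) :=
  finrank_range_sub_cases (z := M.mulVecLin) (w := (M - vecMulVec u v).mulVecLin) (u := u)
    (dotLin_ne_zero hv) fun x => by
      simp [vecMulVec_mulVec]

theorem rank_sub_eq_add_one_iff (hv : v ≠ 0) :
    (M - vecMulVec u v).rank = M.rank + 1 ↔ ¬ InRow M v ∧ ¬ InCol M u := by
  obtain ⟨h1, h2, h3, h4⟩ := rank_sub_cases hv M u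
  by_cases hR : InRow M v <;> by_cases hU : InCol M u <;> by_cases hP : Pairs M u v 1 <;>
    simp only [hR, hU, hP, not_true_eq_false, not_false_eq_true, forall_const, and_true,
      and_false, iff_false, iff_true, and_self, IsEmpty.forall_iff] at * <;> omega

theorem rank_sub_add_one_eq_iff (hv : v ≠ 0) :
    (M - vecMulVec u v).rank + 1 = M.rank ↔ InRow M v ∧ Pairs M u v 1 := by
  obtain ⟨h1, h2, h3, h4⟩ := rank_sub_cases hv M u
  by_cases hR : InRow M v <;> by_cases hU : InCol M u <;> by_cases hP : Pairs M u v 1 <;>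
    simp only [hR, hU, hP, not_true_eq_false, not_false_eq_true, forall_const, and_true,
      and_false, iff_false, iff_true, and_self, IsEmpty.forall_iff] at * <;> omega

end RankOneUpdate

/-! ### Path-length distance as rank. -/

theorem rank_eq_zero_iff {M : Matrix (Fin m) (Fin n) F} : M.rank = 0 ↔ M = 0 := by
  constructor
  · intro h
    have : M.mulVecLin = 0 := by
      rw [← LinearMap.range_eq_bot]
      exact Submodule.finrank_eq_zero.1 h
    ext i j
    have := congrFun (LinearMap.congr_fun this (Pi.single j 1)) i
    simpa using this
  · rintro rfl
    exact rank_zero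

theorem rank_neg_eq (M : Matrix (Fin m) (Fin n) F) : (-M).rank = M.rank := by
  have h : (-M).mulVecLin = -M.mulVecLin := by
    ext; simp
  rw [Matrix.rank, h, LinearMap.range_neg, Matrix.rank]

theorem rank_sub_comm (M K : Matrix (Fin m) (Fin n) F) : (M - K).rank = (K - M).rank := by
  rw [← neg_sub, rank_neg_eq]

theorem rank_vecMulVec_eq_one {u : Fin m → F} {v : Fin n → F} (hu : u ≠ 0) (hv : v ≠ 0) :
    (vecMulVec u v).rank = 1 := by
  have h := (rank_sub_eq_add_one_iff (M := (0 : Matrix (Fin m) (Fin n) F)) (u := u) hv).2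
    ⟨fun h => hv (dotProduct_eq_zero v fun w => h w (zero_mulVec w)), by
      rintro ⟨x, hx⟩
      exact hu (by rw [← hx, zero_mulVec])⟩
  rwa [zero_sub, rank_neg_eq, rank_zero] at h

theorem exists_dotProduct_eq_one {u : Fin m → F} (hu : u ≠ 0) : ∃ y, y ⬝ᵥ u = 1 := by
  obtain ⟨x, hx⟩ := exists_apply_eq_one (dotLin_ne_zero hu)
  exact ⟨x, by rwa [dotProduct_comm]⟩

/-- Wedderburn's rank reduction: if `y ⬝ᵥ (M *ᵥ x) = 1`, subtracting the outer product of `M *ᵥ x`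
and `y ᵥ* M` lowers the rank. Iterated, it produces geodesics. -/
theorem exists_rank_sub_add_one {M : Matrix (Fin m) (Fin n) F} (hM : M ≠ 0) :
    ∃ a b, a ≠ 0 ∧ b ≠ 0 ∧ (M - vecMulVec a b).rank + 1 = M.rank := by
  obtain ⟨x, hx⟩ : ∃ x, M *ᵥ x ≠ 0 := by
    by_contra h
    push Not at h
    exact hM (by ext i j; simpa using congrFun (h (Pi.single j 1)) i)
  obtain ⟨y, hy⟩ := exists_dotProduct_eq_one hx
  have hy' : (y ᵥ* M) ⬝ᵥ x = 1 := by rwa [← dotProduct_mulVec]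
  have hb : y ᵥ* M ≠ 0 := by
    intro h
    rw [h, zero_dotProduct] at hy'
    exact zero_ne_one hy'
  exact ⟨M *ᵥ x, y ᵥ* M, hx, hb, (rank_sub_add_one_eq_iff hb).2
    ⟨inRow_iff.2 ⟨y, rfl⟩, x, rfl, hy'⟩⟩

theorem exists_eq_vecMulVec {M : Matrix (Fin m) (Fin n) F} (hM : M.rank = 1) :
    ∃ a b, a ≠ 0 ∧ b ≠ 0 ∧ M = vecMulVec a b := by
  obtain ⟨a, b, ha, hb, h⟩ := exists_rank_sub_add_one (M := M) (by
    rintro rfl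
    simp at hM)
  exact ⟨a, b, ha, hb, by rw [← sub_eq_zero, ← rank_eq_zero_iff]; omega⟩

theorem rank_le_rank_add_one {M K : Matrix (Fin m) (Fin n) F} (h : (M - K).rank = 1) :
    M.rank ≤ K.rank + 1 := by
  obtain ⟨a, b, -, hb, hab⟩ := exists_eq_vecMulVec h
  obtain rfl : K = M - vecMulVec a b := by rw [← hab, sub_sub_cancel]
  obtain ⟨h1, h2, h3, h4⟩ := rank_sub_cases hb M a
  by_cases hR : InRow M b
  · by_cases hP : Pairs M a b 1
    · exact (h1 hR hP).ge
    · have := h2 hR hP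
      omega
  · by_cases hU : InCol M a
    · have := h3 hR hU
      omega
    · have := h4 hR hU
      omega

theorem exists_walk_length_eq_rank (w : Matrix (Fin m) (Fin n) F) (r : ℕ) :
    ∀ z : Matrix (Fin m) (Fin n) F, (z - w).rank = r →
      ∃ p : (bilinearFormsGraph F m n).Walk z w, p.length = r := by
  induction r with
  | zero =>
    intro z hz
    obtain rfl := sub_eq_zero.1 (rank_eq_zero_iff.1 hz)
    exact ⟨.nil, rfl⟩
  | succ r ih =>
    intro z hz
    obtain ⟨a, b, ha, hb, h⟩ := exists_rank_sub_add_one (M := z - w) (by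
      intro h0
      simp [h0] at hz)
    obtain ⟨p, hp⟩ := ih (z - vecMulVec a b) (by rw [sub_right_comm]; omega)
    have hadj : (bilinearFormsGraph F m n).Adj z (z - vecMulVec a b) := by
      change (z - (z - vecMulVec a b)).rank = 1
      rw [sub_sub_cancel, rank_vecMulVec_eq_one ha hb]
    exact ⟨.cons hadj p, by simp [hp]⟩

theorem rank_sub_le_length {z w : Matrix (Fin m) (Fin n) F}
    (p : (bilinearFormsGraph F m n).Walk z w) : (z - w).rank ≤ p.length := by
  induction p with
  | nil => simp
  | @cons z z' w h p ih =>
    have h1 : (z - z').rank = 1 := h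
    have h2 := rank_le_rank_add_one (M := z - w) (K := z' - w) (by rwa [sub_sub_sub_cancel_right])
    simp only [SimpleGraph.Walk.length_cons]
    omega

/-- The path-length distance in the bilinear forms graph is the rank of the difference. -/
theorem dist_eq_rank (z w : Matrix (Fin m) (Fin n) F) :
    (bilinearFormsGraph F m n).dist z w = (z - w).rank := by
  obtain ⟨p, hp⟩ := exists_walk_length_eq_rank w _ z rfl
  apply le_antisymm
  · rw [← hp]
    exact SimpleGraph.dist_le p
  · obtain ⟨p', hp'⟩ := SimpleGraph.Reachable.exists_walk_length_eq_dist ⟨p⟩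
    rw [← hp']
    exact rank_sub_le_length p'

theorem mem_subconstituent {x z : Matrix (Fin m) (Fin n) F} {i : ℕ} :
    z ∈ (bilinearFormsGraph F m n).subconstituent i x ↔ (z - x).rank = i := by
  rw [SimpleGraph.subconstituent, Set.mem_ofPred_eq, dist_eq_rank, rank_sub_comm]

theorem mem_cell {x y z : Matrix (Fin m) (Fin n) F} {i j : ℕ} :
    z ∈ cell x y i j ↔ (z - x).rank = i ∧ (z - y).rank = j := by
  rw [cell, Set.mem_inter_iff, mem_subconstituent, mem_subconstituent]

/-- Matrices `M`, `M'` with marked nonzero vectors are equivalent as soon as their obvious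
invariants agree. -/
theorem exists_mul_mul_eq {M M' : Matrix (Fin m) (Fin n) F} {u u' : Fin m → F} {v v' : Fin n → F}
    (hu : u ≠ 0) (hu' : u' ≠ 0) (hv : v ≠ 0) (hv' : v' ≠ 0) (hr : M.rank = M'.rank)
    (hU : InCol M u ↔ InCol M' u') (hR : InRow M v ↔ InRow M' v')
    (hφ : InRow M v → ∀ c c', Pairs M u v c → Pairs M' u' v' c' → c = c') :
    ∃ (A : Matrix (Fin m) (Fin m) F) (B : Matrix (Fin n) (Fin n) F), IsUnit A.det ∧ IsUnit B.det ∧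
      A * M * B = M' ∧ A *ᵥ u = u' ∧ v ᵥ* B = v' := by
  obtain ⟨P, Q, hPQ, hP, hQ⟩ := exists_linearEquiv_pair (z := M.mulVecLin) (z' := M'.mulVecLin)
    hu hu' (dotLin_ne_zero hv) (dotLin_ne_zero hv') hr hU hR
    fun h x x' hx hx' => hφ h _ _ ⟨x, hx, rfl⟩ ⟨x', hx', rfl⟩
  have hA : ∀ w, LinearMap.toMatrix' (P : _ →ₗ[F] _) *ᵥ w = P w := fun w =>
    LinearMap.toMatrix'_mulVec _ _
  have hB : ∀ w, LinearMap.toMatrix' (Q.symm : _ →ₗ[F] _) *ᵥ w = Q.symm w := fun w =>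
    LinearMap.toMatrix'_mulVec _ _
  -- Since `z' ∘ Q = P ∘ z`, the right factor is the matrix of the inverse of `Q`.
  refine ⟨LinearMap.toMatrix' (P : _ →ₗ[F] _), LinearMap.toMatrix' (Q.symm : _ →ₗ[F] _),
    ?_, ?_, ?_, ?_, ?_⟩
  · rw [LinearMap.det_toMatrix']
    exact LinearEquiv.isUnit_det' P
  · rw [LinearMap.det_toMatrix']
    exact LinearEquiv.isUnit_det' Q.symm
  · apply Matrix.ext_of_mulVec_single
    intro i
    rw [← mulVec_mulVec, ← mulVec_mulVec, hB, hA]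
    have := hPQ (Q.symm (Pi.single i 1))
    rw [LinearEquiv.apply_symm_apply] at this
    exact this.symm
  · rw [hA, hP]
  · apply dotProduct_eq
    intro w
    rw [← dotProduct_mulVec, hB]
    have := hQ (Q.symm w)
    rw [LinearEquiv.apply_symm_apply] at this
    exact this.symm

/-! ### Invariance under multiplication by invertible matrices. -/

section Equivalence

variable {A : Matrix (Fin m) (Fin m) F} {B : Matrix (Fin n) (Fin n) F}
  {M : Matrix (Fin m) (Fin n) F} {u : Fin m → F} {v : Fin n → F}

theorem rank_mul_mul (hA : IsUnit A.det) (hB : IsUnit B.det) (M : Matrix (Fin m) (Fin n) F) :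
    (A * M * B).rank = M.rank := by
  rw [rank_mul_eq_left_of_isUnit_det _ _ hB, rank_mul_eq_right_of_isUnit_det _ _ hA]

theorem mul_mul_bijective (hA : IsUnit A.det) (hB : IsUnit B.det) :
    Function.Bijective fun M : Matrix (Fin m) (Fin n) F => A * M * B := by
  refine Function.bijective_iff_has_inverse.2 ⟨fun M => A⁻¹ * M * B⁻¹, fun M => ?_, fun M => ?_⟩
  · change A⁻¹ * (A * M * B) * B⁻¹ = M
    rw [Matrix.mul_assoc A M B, nonsing_inv_mul_cancel_left _ _ hA,
      mul_nonsing_inv_cancel_right _ _ hB]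
  · change A * (A⁻¹ * M * B⁻¹) * B = M
    rw [Matrix.mul_assoc A⁻¹ M, mul_nonsing_inv_cancel_left _ _ hA,
      nonsing_inv_mul_cancel_right _ _ hB]

theorem pairs_mul_mul (hA : IsUnit A.det) (hB : IsUnit B.det) {c : F} :
    Pairs (A * M * B) (A *ᵥ u) (v ᵥ* B) c ↔ Pairs M u v c := by
  constructor
  · rintro ⟨x, hx, rfl⟩
    refine ⟨B *ᵥ x, ?_, dotProduct_mulVec v B x⟩
    rw [← mulVec_mulVec, ← mulVec_mulVec] at hx
    exact mulVec_injective_of_isUnit ((isUnit_iff_isUnit_det _).2 hA) hx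
  · rintro ⟨x, rfl, rfl⟩
    refine ⟨B⁻¹ *ᵥ x, ?_, ?_⟩
    · rw [← mulVec_mulVec, ← mulVec_mulVec, mulVec_mulVec _ B, mul_nonsing_inv _ hB, one_mulVec]
    · rw [← dotProduct_mulVec, mulVec_mulVec, mul_nonsing_inv _ hB, one_mulVec]

theorem inCol_iff_exists_pairs (v : Fin n → F) : InCol M u ↔ ∃ c, Pairs M u v c :=
  ⟨fun h => h.exists_pairs v, fun ⟨_, h⟩ => h.inCol⟩

theorem inCol_mul_mul (hA : IsUnit A.det) (hB : IsUnit B.det) :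
    InCol (A * M * B) (A *ᵥ u) ↔ InCol M u := by
  -- The functional is immaterial; `0 ᵥ* B` has the shape that `pairs_mul_mul` needs.
  rw [inCol_iff_exists_pairs (0 ᵥ* B), inCol_iff_exists_pairs 0]
  simp only [pairs_mul_mul hA hB]

theorem inRow_mul_mul (hA : IsUnit A.det) (hB : IsUnit B.det) :
    InRow (A * M * B) (v ᵥ* B) ↔ InRow M v := by
  rw [← inCol_transpose, ← inCol_transpose, transpose_mul, transpose_mul, ← mulVec_transpose,
    ← Matrix.mul_assoc]
  exact inCol_mul_mul (by rwa [det_transpose]) (by rwa [det_transpose])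

end Equivalence

/-! ### Labels of matrices and their ranges. -/

open Classical in
/-- The cell containing `M`, relative to `0` and `vecMulVec u v`: the first component is
`0, …, 5` for `O_{i,i-1}`, `O^A_{i,i}`, `O^B_{i,i}`, `O^C_{i,i}`, `O^D_{i,i}`, `O_{i-1,i}`, and the
second component is `i`. -/
noncomputable def label (u : Fin m → F) (v : Fin n → F) (M : Matrix (Fin m) (Fin n) F) :
    (_ : Fin 6) × ℕ :=
  if InRow M v then
    if Pairs M u v 1 then ⟨0, M.rank⟩ else if Pairs M u v 0 then ⟨1, M.rank⟩
    else if InCol M u then ⟨2, M.rank⟩ else ⟨4, M.rank⟩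
  -- O_{i-1,i} is indexed by the distance to `vecMulVec u v`, here one more than the rank.
  else if InCol M u then ⟨3, M.rank⟩ else ⟨5, M.rank + 1⟩

section Label

variable {u : Fin m → F} {v : Fin n → F} {M : Matrix (Fin m) (Fin n) F} {i : ℕ}

theorem label_eq_zero_iff :
    label u v M = ⟨0, i⟩ ↔ InRow M v ∧ Pairs M u v 1 ∧ M.rank = i := by
  unfold label
  split_ifs <;> simp [*]

theorem label_eq_one_iff :
    label u v M = ⟨1, i⟩ ↔ InRow M v ∧ Pairs M u v 0 ∧ M.rank = i := by
  have h : InRow M v → Pairs M u v 1 → ¬ Pairs M u v 0 := fun hR h1 h0 =>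
    one_ne_zero (hR.pairs_unique h1 h0)
  unfold label
  split_ifs <;> simp_all

theorem label_eq_two_iff :
    label u v M = ⟨2, i⟩ ↔
      InRow M v ∧ InCol M u ∧ ¬ Pairs M u v 1 ∧ ¬ Pairs M u v 0 ∧ M.rank = i := by
  unfold label
  split_ifs <;> simp [*]

theorem label_eq_three_iff :
    label u v M = ⟨3, i⟩ ↔ ¬ InRow M v ∧ InCol M u ∧ M.rank = i := by
  unfold label
  split_ifs <;> simp [*]

theorem label_eq_four_iff :
    label u v M = ⟨4, i⟩ ↔ InRow M v ∧ ¬ InCol M u ∧ M.rank = i := by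
  have h1 : Pairs M u v 1 → InCol M u := Pairs.inCol
  have h0 : Pairs M u v 0 → InCol M u := Pairs.inCol
  unfold label
  split_ifs <;> simp_all

theorem label_eq_five_iff :
    label u v M = ⟨5, i⟩ ↔ ¬ InRow M v ∧ ¬ InCol M u ∧ M.rank + 1 = i := by
  unfold label
  split_ifs <;> simp [*]

theorem rank_pair_eq_pred_iff (hv : v ≠ 0) (hi : 1 ≤ i) :
    (M.rank = i ∧ (M - vecMulVec u v).rank = i - 1) ↔ label u v M = ⟨0, i⟩ := by
  rw [label_eq_zero_iff, ← and_assoc, ← rank_sub_add_one_eq_iff hv]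
  omega

theorem rank_pair_eq_succ_iff (hv : v ≠ 0) (hi : 1 ≤ i) :
    (M.rank = i - 1 ∧ (M - vecMulVec u v).rank = i) ↔ label u v M = ⟨5, i⟩ := by
  rw [label_eq_five_iff, ← and_assoc, ← rank_sub_eq_add_one_iff hv]
  omega

theorem rank_pair_eq_iff (hv : v ≠ 0) :
    (M.rank = i ∧ (M - vecMulVec u v).rank = i) ↔
      label u v M = ⟨1, i⟩ ∨ label u v M = ⟨2, i⟩ ∨ label u v M = ⟨3, i⟩ ∨ label u v M = ⟨4, i⟩ := by
  rw [label_eq_one_iff, label_eq_two_iff, label_eq_three_iff, label_eq_four_iff]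
  obtain ⟨h1, h2, h3, h4⟩ := rank_sub_cases hv M u
  have h5 : Pairs M u v 1 → InCol M u := Pairs.inCol
  have h6 : Pairs M u v 0 → InCol M u := Pairs.inCol
  have h7 : InRow M v → Pairs M u v 1 → ¬ Pairs M u v 0 := fun hR h1 h0 =>
    one_ne_zero (hR.pairs_unique h1 h0)
  by_cases hR : InRow M v <;> by_cases hU : InCol M u <;> by_cases hP : Pairs M u v 1 <;>
    by_cases hP0 : Pairs M u v 0 <;> simp_all <;> omega

/-- In a rank-one matrix `vecMulVec a b`, `u` and `v` would be nonzero multiples of `a` and `b`, and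
their pairing would not vanish. This is why O^A starts at `i = 2`. -/
theorem two_le_rank_of_pairs_zero (hu : u ≠ 0) (hv : v ≠ 0) (hR : InRow M v)
    (h0 : Pairs M u v 0) : 2 ≤ M.rank := by
  obtain ⟨x, rfl, hx⟩ := h0
  by_contra hlt
  have hM : M ≠ 0 := by
    rintro rfl
    exact hu (zero_mulVec x)
  have h1 : M.rank ≠ 0 := mt rank_eq_zero_iff.1 hM
  obtain ⟨a, b, -, -, rfl⟩ := exists_eq_vecMulVec (M := M) (by omega)
  obtain ⟨y, rfl⟩ := inRow_iff.1 hR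
  rw [vecMulVec_mulVec] at hu
  rw [vecMul_vecMulVec] at hv hx
  rw [smul_dotProduct, smul_eq_mul, mul_eq_zero] at hx
  rcases hx with hx | hx
  · exact hv (by rw [hx, zero_smul])
  · exact hu (by rw [hx]; simp)

theorem one_le_rank_of_inCol (hu : u ≠ 0) (h : InCol M u) : 1 ≤ M.rank := by
  by_contra hlt
  obtain rfl := rank_eq_zero_iff.1 (show M.rank = 0 by omega)
  obtain ⟨x, rfl⟩ := h
  exact hu (zero_mulVec x)

theorem one_le_rank_of_inRow (hv : v ≠ 0) (h : InRow M v) : 1 ≤ M.rank := by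
  rw [← rank_transpose]
  exact one_le_rank_of_inCol hv (inCol_transpose.2 h)

/-- This is why O^D stops at `m - 1`, and why the index `M.rank + 1` of O_{i-1,i} stays within `m`.
-/
theorem rank_lt_of_not_inCol (h : ¬ InCol M u) : M.rank < m := by
  have hlt : LinearMap.range M.mulVecLin < ⊤ := by
    rw [lt_top_iff_ne_top]
    intro htop
    have : u ∈ LinearMap.range M.mulVecLin := htop ▸ Submodule.mem_top
    exact h this
  have := Submodule.finrank_lt_finrank_of_lt hlt
  rwa [finrank_top, finrank_fin_fun] at this

/-- The least index `i` for which the cells of the given kind are used. -/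
def lowIndex (k : Fin 6) : ℕ := if k = 1 then 2 else 1

/-- The largest index `i` for which the cells of the given kind are used. -/
def highIndex (m : ℕ) (k : Fin 6) : ℕ := if k = 4 then m - 1 else m

/-- The labels of the cells of the partition. -/
def labels (m : ℕ) : Finset ((_ : Fin 6) × ℕ) :=
  Finset.univ.sigma fun k => Finset.Icc (lowIndex k) (highIndex m k)

theorem card_labels (hm : 3 ≤ m) : (labels m).card = 6 * m - 2 := by
  simp [labels, Fin.sum_univ_succ, lowIndex, highIndex]
  omega

theorem label_mem_labels (hu : u ≠ 0) (hv : v ≠ 0) : label u v M ∈ labels m := by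
  have hm : M.rank ≤ m := M.rank_le_height
  have h1 : InCol M u → 1 ≤ M.rank := one_le_rank_of_inCol hu
  have h2 : InRow M v → 1 ≤ M.rank := one_le_rank_of_inRow hv
  have h3 : ¬ InCol M u → M.rank < m := rank_lt_of_not_inCol
  have h4 : InRow M v → Pairs M u v 0 → 2 ≤ M.rank := two_le_rank_of_pairs_zero hu hv
  unfold label
  split_ifs <;> simp_all [labels, lowIndex, highIndex] <;> omega

end Label

/-! ### Counting rank-one updates and common neighbours. -/

section Counting

variable {u : Fin m → F} {v : Fin n → F} {M : Matrix (Fin m) (Fin n) F} {i : ℕ}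

theorem vecMulVec_zero_right (u : Fin m → F) : vecMulVec u (0 : Fin n → F) = 0 := by
  ext i j
  simp [vecMulVec_apply]

/-- The vectors `b` for which `M - vecMulVec u b` has rank `j`. -/
def rowUpdates (M : Matrix (Fin m) (Fin n) F) (u : Fin m → F) (j : ℕ) : Set (Fin n → F) :=
  {b | (M - vecMulVec u b).rank = j}

theorem ncard_rowSpace [Finite F] (M : Matrix (Fin m) (Fin n) F) :
    {b | InRow M b}.ncard = Nat.card F ^ M.rank := by
  have : {b | InRow M b} = (LinearMap.range Mᵀ.mulVecLin : Set (Fin n → F)) := by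
    ext b
    exact inCol_transpose.symm
  rw [this, ← Nat.card_coe_set_eq, ← rank_transpose]
  exact Module.natCard_eq_pow_finrank (K := F)

theorem ncard_affine_hyperplane [Finite F] {V : Type*} [AddCommGroup V] [Module F V] [FiniteDimensional F V]
    {R : Submodule F V} (f : V →ₗ[F] F) {b : V} (hb : b ∈ R) (hfb : f b = 1) :
    {x | x ∈ R ∧ f x = 1}.ncard = Nat.card F ^ (finrank F R - 1) := by
  have hsurj : LinearMap.range (f.domRestrict R) = ⊤ := by
    rw [LinearMap.range_eq_top]
    intro c
    exact ⟨c • ⟨b, hb⟩, by simp [hfb]⟩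
  have hfin := (f.domRestrict R).finrank_range_add_finrank_ker
  rw [hsurj, finrank_top, finrank_self] at hfin
  have himage : {x | x ∈ R ∧ f x = 1} =
      (fun k : LinearMap.ker (f.domRestrict R) => b + (k : R)) '' Set.univ := by
    ext x
    constructor
    · rintro ⟨hx, hfx⟩
      exact ⟨⟨⟨x - b, R.sub_mem hx hb⟩, by simp [hfx, hfb]⟩, trivial, by simp⟩
    · rintro ⟨k, -, rfl⟩
      have : f (k : R) = 0 := k.2
      exact ⟨R.add_mem hb (k : R).2, by rw [map_add, hfb, this, add_zero]⟩
  rw [himage, Set.ncard_image_of_injective _ (by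
    intro k k' h
    exact Subtype.ext (Subtype.ext (add_left_cancel h))), Set.ncard_univ,
    Module.natCard_eq_pow_finrank (K := F)]
  congr 1
  omega

theorem rowUpdates_pred_eq (hi : 1 ≤ i) (hM : M.rank = i) :
    rowUpdates M u (i - 1) = {b | InRow M b ∧ Pairs M u b 1} := by
  ext b
  simp only [rowUpdates, Set.mem_ofPred_eq]
  -- The rank table needs `b ≠ 0`. The zero update keeps the rank at `i`, which differs from `i - 1`
  -- because `1 ≤ i`.
  by_cases hb : b = 0
  · subst hb
    simp only [vecMulVec_zero_right, sub_zero, hM]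
    constructor
    · omega
    · rintro ⟨-, x, -, hx⟩
      simp at hx
  · rw [← rank_sub_add_one_eq_iff hb]
    omega

theorem rowUpdates_succ_eq (hM : M.rank = i) :
    rowUpdates M u (i + 1) = {b | ¬ InRow M b ∧ ¬ InCol M u} := by
  ext b
  simp only [rowUpdates, Set.mem_ofPred_eq]
  by_cases hb : b = 0
  · subst hb
    simp only [vecMulVec_zero_right, sub_zero, hM]
    constructor
    · omega
    · rintro ⟨h, -⟩
      exact absurd (fun x _ => zero_dotProduct x) h
  · rw [← rank_sub_eq_add_one_iff hb, hM]

/-- With `M *ᵥ x = u`, the admissible `b` are the row-space vectors with `b ⬝ᵥ x = 1`: an affine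
hyperplane of an `i`-dimensional space, nonempty since it contains `y ᵥ* M` for any `y` with `y ⬝ᵥ u
= 1`. -/
theorem ncard_rowUpdates_pred [Finite F] (hu : u ≠ 0) (hi : 1 ≤ i) (hM : M.rank = i) (h : InCol M u) :
    (rowUpdates M u (i - 1)).ncard = Nat.card F ^ (i - 1) := by
  rw [rowUpdates_pred_eq hi hM]
  obtain ⟨x, hx⟩ := h
  obtain ⟨y, hy⟩ := exists_dotProduct_eq_one hu
  rw [← hM, ← rank_transpose]
  have hset : {b | InRow M b ∧ Pairs M u b 1} =
      {b | b ∈ LinearMap.range Mᵀ.mulVecLin ∧ dotLin x b = 1} := by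
    ext b
    have : b ∈ LinearMap.range Mᵀ.mulVecLin ↔ InRow M b := inCol_transpose
    simp only [Set.mem_ofPred_eq, this, dotLin_apply]
    refine and_congr_right fun hb => ?_
    constructor
    · rintro ⟨x', hx', h1⟩
      rw [dotProduct_comm, ← h1]
      exact hb.dotProduct_eq (hx.trans hx'.symm)
    · intro h1
      exact ⟨x, hx, by rwa [dotProduct_comm]⟩
  rw [hset]
  refine ncard_affine_hyperplane (R := LinearMap.range Mᵀ.mulVecLin) _ (b := y ᵥ* M)
    ⟨y, by simp⟩ ?_
  rw [dotLin_apply, dotProduct_comm, ← dotProduct_mulVec, hx, hy]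

theorem rowUpdates_pred_of_not_inCol (hi : 1 ≤ i) (hM : M.rank = i) (h : ¬ InCol M u) :
    rowUpdates M u (i - 1) = ∅ := by
  rw [rowUpdates_pred_eq hi hM, Set.eq_empty_iff_forall_notMem]
  exact fun b hb => h hb.2.inCol

theorem rowUpdates_succ_of_inCol (hM : M.rank = i) (h : InCol M u) :
    rowUpdates M u (i + 1) = ∅ := by
  rw [rowUpdates_succ_eq hM, Set.eq_empty_iff_forall_notMem]
  exact fun b hb => hb.2 h

theorem ncard_rowUpdates_succ [Finite F] (hM : M.rank = i) (h : ¬ InCol M u) :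
    (rowUpdates M u (i + 1)).ncard = Nat.card F ^ n - Nat.card F ^ i := by
  rw [rowUpdates_succ_eq hM]
  have hset : {b | ¬ InRow M b ∧ ¬ InCol M u} = {b | InRow M b}ᶜ := by
    ext b
    simp [h]
  rw [hset, Set.ncard_compl, ncard_rowSpace, hM]
  simp [Nat.card_fun]

/-- The common neighbours of `0` and `vecMulVec u v` at distance `j` from `M`. -/
def commonSet (u : Fin m → F) (v : Fin n → F) (M : Matrix (Fin m) (Fin n) F) (j : ℕ) :
    Set (Matrix (Fin m) (Fin n) F) :=
  {K | K.rank = 1 ∧ (K - vecMulVec u v).rank = 1 ∧ (M - K).rank = j}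

theorem vecMulVec_left_injective (hu : u ≠ 0) :
    Function.Injective (vecMulVec u : (Fin n → F) → Matrix (Fin m) (Fin n) F) := by
  intro b b' h
  obtain ⟨k, hk⟩ := Function.ne_iff.1 hu
  ext j
  have := congrFun (congrFun h k) j
  simp only [vecMulVec_apply] at this
  exact mul_left_cancel₀ hk this

theorem vecMulVec_right_injective (hv : v ≠ 0) :
    Function.Injective (fun a : Fin m → F => vecMulVec a v) := by
  intro a a' h
  have h' := congrArg Matrix.transpose h
  simp only [transpose_vecMulVec] at h'
  exact vecMulVec_left_injective hv h'

/-- If `K` and `K - vecMulVec u v` both have rank 1, the update does not raise the rank, so `K`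
shares its row line or its column line with `vecMulVec u v`. The hypotheses on `j` exclude `0` and
`vecMulVec u v` themselves from the two families. -/
theorem commonSet_eq (hu : u ≠ 0) (hv : v ≠ 0) {j : ℕ} (h0 : M.rank ≠ j)
    (h1 : (M - vecMulVec u v).rank ≠ j) :
    commonSet u v M j =
      vecMulVec u '' rowUpdates M u j ∪ (fun a => vecMulVec a v) '' rowUpdates Mᵀ v j := by
  have hT : ∀ a, (Mᵀ - vecMulVec v a).rank = (M - vecMulVec a v).rank := by
    intro a
    rw [← rank_transpose, transpose_sub, transpose_transpose, transpose_vecMulVec]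
  ext K
  simp only [commonSet, rowUpdates, Set.mem_ofPred_eq, Set.mem_union, Set.mem_image, hT]
  constructor
  · rintro ⟨hK, hK', hj⟩
    obtain ⟨a, b, ha, hb, rfl⟩ := exists_eq_vecMulVec hK
    have := (not_congr (rank_sub_eq_add_one_iff (M := vecMulVec a b) (u := u) hv)).1 (by omega)
    rw [not_and_or, not_not, not_not] at this
    rcases this with h | h
    · right
      obtain ⟨y, rfl⟩ := inRow_iff.1 h
      rw [vecMul_vecMulVec] at hv ⊢
      have hc : y ⬝ᵥ a ≠ 0 := fun hc => hv (by rw [hc, zero_smul])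
      -- The scalar is moved across the outer product so that the right factor becomes `v` itself.
      have hE : vecMulVec ((y ⬝ᵥ a)⁻¹ • a) ((y ⬝ᵥ a) • b) = vecMulVec a b := by
        rw [smul_vecMulVec, vecMulVec_smul, smul_smul, inv_mul_cancel₀ hc, one_smul]
      exact ⟨_, by rw [hE, hj], hE⟩
    · left
      obtain ⟨x, rfl⟩ := h
      rw [vecMulVec_mulVec] at hu ⊢
      simp only [op_smul_eq_smul] at hu ⊢
      have hc : b ⬝ᵥ x ≠ 0 := fun hc => hu (by rw [hc, zero_smul])
      have hE : vecMulVec ((b ⬝ᵥ x) • a) ((b ⬝ᵥ x)⁻¹ • b) = vecMulVec a b := by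
        rw [smul_vecMulVec, vecMulVec_smul, smul_smul, mul_inv_cancel₀ hc, one_smul]
      exact ⟨_, by rw [hE, hj], hE⟩
  · rintro (⟨b, hb, rfl⟩ | ⟨a, ha, rfl⟩)
    · refine ⟨rank_vecMulVec_eq_one hu ?_, ?_, hb⟩
      · rintro rfl
        exact h0 (by simpa [vecMulVec_zero_right] using hb)
      · rw [← vecMulVec_sub]
        refine rank_vecMulVec_eq_one hu (sub_ne_zero.2 ?_)
        rintro rfl
        exact h1 hb
    · refine ⟨rank_vecMulVec_eq_one ?_ hv, ?_, ha⟩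
      · rintro rfl
        exact h0 (by simpa using ha)
      · rw [← sub_vecMulVec]
        refine rank_vecMulVec_eq_one (sub_ne_zero.2 ?_) hv
        rintro rfl
        exact h1 ha

/-- A matrix in both families is a multiple `s` of `vecMulVec u v`, and lowering the rank forces `s
* (v ⬝ᵥ x) = 1`. This single overlap, present when the pairing value is nonzero, accounts for the `-
1` in the definition of O^B. -/
theorem inter_image_rowUpdates (hu : u ≠ 0) (hi : 1 ≤ i) (hM : M.rank = i)
    {x : Fin n → F} (hR : InRow M v) (hx : M *ᵥ x = u) :
    vecMulVec u '' rowUpdates M u (i - 1) ∩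
        (fun a => vecMulVec a v) '' rowUpdates Mᵀ v (i - 1) =
      {K | v ⬝ᵥ x ≠ 0 ∧ K = vecMulVec u ((v ⬝ᵥ x)⁻¹ • v)} := by
  have hT : ∀ a, (Mᵀ - vecMulVec v a).rank = (M - vecMulVec a v).rank := by
    intro a
    rw [← rank_transpose, transpose_sub, transpose_transpose, transpose_vecMulVec]
  have key : ∀ b, b ∈ rowUpdates M u (i - 1) ↔ InRow M b ∧ b ⬝ᵥ x = 1 := by
    intro b
    rw [rowUpdates_pred_eq hi hM]
    refine and_congr_right fun hb => ⟨?_, fun h => ⟨x, hx, h⟩⟩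
    rintro ⟨x', hx', h1⟩
    rw [← h1]
    exact hb.dotProduct_eq (hx.trans hx'.symm)
  ext K
  constructor
  · rintro ⟨⟨b, hb, rfl⟩, a, ha, hab⟩
    obtain ⟨k, hk⟩ := Function.ne_iff.1 hu
    have hbv : b = ((u k)⁻¹ * a k) • v := by
      ext j
      have := congrFun (congrFun hab k) j
      simp only [vecMulVec_apply] at this
      rw [Pi.smul_apply, smul_eq_mul, mul_assoc, this, inv_mul_cancel_left₀ hk]
    have h1 := ((key b).1 hb).2
    rw [hbv, smul_dotProduct, smul_eq_mul] at h1
    refine ⟨right_ne_zero_of_mul_eq_one h1, ?_⟩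
    rw [hbv, eq_inv_of_mul_eq_one_left h1]
  · rintro ⟨hc, rfl⟩
    have hb : (v ⬝ᵥ x)⁻¹ • v ∈ rowUpdates M u (i - 1) := by
      rw [key]
      refine ⟨fun w hw => ?_, ?_⟩
      · rw [smul_dotProduct, hR w hw, smul_zero]
      · rw [smul_dotProduct, smul_eq_mul, inv_mul_cancel₀ hc]
    have hE : vecMulVec ((v ⬝ᵥ x)⁻¹ • u) v = vecMulVec u ((v ⬝ᵥ x)⁻¹ • v) := by
      rw [smul_vecMulVec, vecMulVec_smul]
    refine ⟨⟨_, hb, rfl⟩, (v ⬝ᵥ x)⁻¹ • u, ?_, hE⟩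
    change (Mᵀ - _).rank = _
    rw [hT, hE]
    exact hb

end Counting

/-! ### The cells as fibres of the label. -/

section CommonCount

variable {u : Fin m → F} {v : Fin n → F} {M : Matrix (Fin m) (Fin n) F} {i : ℕ}

theorem ncard_image_rowUpdates (hu : u ≠ 0) (j : ℕ) :
    (vecMulVec u '' rowUpdates M u j).ncard = (rowUpdates M u j).ncard :=
  Set.ncard_image_of_injective _ (vecMulVec_left_injective hu)

theorem ncard_image_rowUpdates_transpose (hv : v ≠ 0) (j : ℕ) :
    ((fun a => vecMulVec a v) '' rowUpdates Mᵀ v j).ncard = (rowUpdates Mᵀ v j).ncard :=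
  Set.ncard_image_of_injective _ (vecMulVec_right_injective hv)

/-- Inclusion–exclusion for the two families; the second summand, 1 or 0, is the size of their
overlap. -/
theorem ncard_commonSet_pred_add [Finite F] (hu : u ≠ 0) (hv : v ≠ 0) (hi : 1 ≤ i) (hM : M.rank = i)
    (hM' : (M - vecMulVec u v).rank = i) (hU : InCol M u) (hR : InRow M v) :
    (commonSet u v M (i - 1)).ncard + {c : F | c ≠ 0 ∧ Pairs M u v c}.ncard =
      2 * Nat.card F ^ (i - 1) := by
  obtain ⟨x, hx⟩ := id hU
  have h := Set.ncard_union_add_ncard_inter (vecMulVec u '' rowUpdates M u (i - 1))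
    ((fun a => vecMulVec a v) '' rowUpdates Mᵀ v (i - 1)) (Set.toFinite _) (Set.toFinite _)
  rw [← commonSet_eq hu hv (by omega) (by omega), inter_image_rowUpdates hu hi hM hR hx,
    ncard_image_rowUpdates hu, ncard_image_rowUpdates_transpose hv,
    ncard_rowUpdates_pred hu hi hM hU,
    ncard_rowUpdates_pred hv hi (by rwa [rank_transpose]) (inCol_transpose.2 hR)] at h
  rw [two_mul, ← h]
  congr 1
  have hc : ∀ c, Pairs M u v c ↔ c = v ⬝ᵥ x := fun c =>
    ⟨fun h => hR.pairs_unique h ⟨x, hx, rfl⟩, fun h => ⟨x, hx, h.symm⟩⟩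
  by_cases h0 : v ⬝ᵥ x = 0
  · have h1 : {c : F | c ≠ 0 ∧ Pairs M u v c} = ∅ := by
      ext c
      simp only [hc, h0, Set.mem_ofPred_eq, Set.mem_empty_iff_false, iff_false]
      tauto
    have h2 : {K | v ⬝ᵥ x ≠ 0 ∧ K = vecMulVec u ((v ⬝ᵥ x)⁻¹ • v)} = ∅ := by
      ext c
      simp [h0]
    rw [h1, h2, Set.ncard_empty, Set.ncard_empty]
  · have h1 : {c : F | c ≠ 0 ∧ Pairs M u v c} = {v ⬝ᵥ x} := by
      ext c
      simp only [hc, Set.mem_ofPred_eq, Set.mem_singleton_iff]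
      constructor
      · exact And.right
      · rintro rfl
        exact ⟨h0, rfl⟩
    have h2 : {K | v ⬝ᵥ x ≠ 0 ∧ K = vecMulVec u ((v ⬝ᵥ x)⁻¹ • v)} =
        {vecMulVec u ((v ⬝ᵥ x)⁻¹ • v)} := by
      ext c
      simp [h0]
    rw [h1, h2, Set.ncard_singleton, Set.ncard_singleton]

theorem ncard_commonSet_of_label_one [Finite F] (hu : u ≠ 0) (hv : v ≠ 0) (hi : 1 ≤ i)
    (h : label u v M = ⟨1, i⟩) :
    (commonSet u v M (i - 1)).ncard = 2 * Nat.card F ^ (i - 1) ∧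
      (commonSet u v M (i + 1)).ncard = 0 := by
  obtain ⟨hM, hM'⟩ := (rank_pair_eq_iff hv).2 (Or.inl h)
  obtain ⟨hR, h0, -⟩ := label_eq_one_iff.1 h
  have h1 := ncard_commonSet_pred_add hu hv hi hM hM' h0.inCol hR
  have h2 : {c : F | c ≠ 0 ∧ Pairs M u v c} = ∅ :=
    Set.eq_empty_iff_forall_notMem.2 fun c hc => hc.1 (hR.pairs_unique hc.2 h0)
  rw [h2, Set.ncard_empty, add_zero] at h1
  refine ⟨h1, ?_⟩
  rw [commonSet_eq hu hv (by omega) (by omega), rowUpdates_succ_of_inCol hM h0.inCol,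
    rowUpdates_succ_of_inCol (by rwa [rank_transpose]) (inCol_transpose.2 hR)]
  simp

theorem ncard_commonSet_of_label_two [Finite F] (hu : u ≠ 0) (hv : v ≠ 0) (hi : 1 ≤ i)
    (h : label u v M = ⟨2, i⟩) :
    (commonSet u v M (i - 1)).ncard = 2 * Nat.card F ^ (i - 1) - 1 ∧
      (commonSet u v M (i + 1)).ncard = 0 := by
  obtain ⟨hM, hM'⟩ := (rank_pair_eq_iff hv).2 (Or.inr (Or.inl h))
  obtain ⟨hR, hU, -, h0, -⟩ := label_eq_two_iff.1 h
  have h1 := ncard_commonSet_pred_add hu hv hi hM hM' hU hR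
  obtain ⟨c, hc⟩ := hU.exists_pairs v
  have hc0 : c ≠ 0 := by
    rintro rfl
    exact h0 hc
  have h2 : {c : F | c ≠ 0 ∧ Pairs M u v c} = {c} := by
    ext c'
    constructor
    · exact fun h => hR.pairs_unique h.2 hc
    · rintro rfl
      exact ⟨hc0, hc⟩
  rw [h2, Set.ncard_singleton] at h1
  refine ⟨by omega, ?_⟩
  rw [commonSet_eq hu hv (by omega) (by omega), rowUpdates_succ_of_inCol hM hU,
    rowUpdates_succ_of_inCol (by rwa [rank_transpose]) (inCol_transpose.2 hR)]
  simp

/-- At each of the two distances only one family contributes: updates along `u` can lower the rank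
but not raise it, those along `v` can raise it but not lower it. -/
theorem ncard_commonSet_of_label_three [Finite F] (hu : u ≠ 0) (hv : v ≠ 0) (hi : 1 ≤ i)
    (h : label u v M = ⟨3, i⟩) :
    (commonSet u v M (i - 1)).ncard = Nat.card F ^ (i - 1) ∧
      (commonSet u v M (i + 1)).ncard = Nat.card F ^ m - Nat.card F ^ i := by
  obtain ⟨hM, hM'⟩ := (rank_pair_eq_iff hv).2 (Or.inr (Or.inr (Or.inl h)))
  obtain ⟨hR, hU, -⟩ := label_eq_three_iff.1 h
  have hMT : Mᵀ.rank = i := by rwa [rank_transpose]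
  rw [← inCol_transpose] at hR
  constructor
  · rw [commonSet_eq hu hv (by omega) (by omega), rowUpdates_pred_of_not_inCol hi hMT hR,
      Set.image_empty, Set.union_empty, ncard_image_rowUpdates hu,
      ncard_rowUpdates_pred hu hi hM hU]
  · rw [commonSet_eq hu hv (by omega) (by omega), rowUpdates_succ_of_inCol hM hU,
      Set.image_empty, Set.empty_union, ncard_image_rowUpdates_transpose hv,
      ncard_rowUpdates_succ hMT hR]

theorem ncard_commonSet_of_label_four [Finite F] (hu : u ≠ 0) (hv : v ≠ 0) (hi : 1 ≤ i)
    (h : label u v M = ⟨4, i⟩) :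
    (commonSet u v M (i - 1)).ncard = Nat.card F ^ (i - 1) ∧
      (commonSet u v M (i + 1)).ncard = Nat.card F ^ n - Nat.card F ^ i := by
  obtain ⟨hM, hM'⟩ := (rank_pair_eq_iff hv).2 (Or.inr (Or.inr (Or.inr h)))
  obtain ⟨hR, hU, -⟩ := label_eq_four_iff.1 h
  have hMT : Mᵀ.rank = i := by rwa [rank_transpose]
  rw [← inCol_transpose] at hR
  constructor
  · rw [commonSet_eq hu hv (by omega) (by omega), rowUpdates_pred_of_not_inCol hi hM hU,
      Set.image_empty, Set.empty_union, ncard_image_rowUpdates_transpose hv,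
      ncard_rowUpdates_pred hv hi hMT hR]
  · rw [commonSet_eq hu hv (by omega) (by omega), rowUpdates_succ_of_inCol hMT hR,
      Set.image_empty, Set.union_empty, ncard_image_rowUpdates hu,
      ncard_rowUpdates_succ hM hU]

theorem commonCount_eq {x y : Matrix (Fin m) (Fin n) F} (hy : y - x = vecMulVec u v) (j : ℕ)
    (z : Matrix (Fin m) (Fin n) F) :
    commonCount x y j z = (commonSet u v (z - x) j).ncard := by
  have : (bilinearFormsGraph F m n).subconstituent 1 x ∩
      (bilinearFormsGraph F m n).subconstituent 1 y ∩
      (bilinearFormsGraph F m n).subconstituent j z = (fun K => K + x) '' commonSet u v (z - x) j := by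
    ext w
    simp only [Set.mem_inter_iff, mem_subconstituent, commonSet, Set.mem_image, Set.mem_ofPred_eq]
    constructor
    · rintro ⟨⟨h1, h2⟩, h3⟩
      refine ⟨w - x, ⟨h1, ?_, ?_⟩, by simp⟩
      · rwa [← hy, sub_sub_sub_cancel_right]
      · rwa [sub_sub_sub_cancel_right, rank_sub_comm]
    · rintro ⟨K, ⟨h1, h2, h3⟩, rfl⟩
      refine ⟨⟨by simpa using h1, ?_⟩, ?_⟩
      · rw [← h2, ← hy]
        congr 1
        abel
      · rw [rank_sub_comm, ← h3]
        congr 1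
        abel
  rw [commonCount, this, Set.ncard_image_of_injective _ (add_left_injective x)]

/-- The cell with label `⟨k, i⟩`, in terms of distances in the graph. -/
noncomputable def cellOfLabel (x y : Matrix (Fin m) (Fin n) F) (k : Fin 6) (i : ℕ) :
    Set (Matrix (Fin m) (Fin n) F) :=
  match k with
  | 0 => cell x y i (i - 1)
  | 1 => cellA x y i
  | 2 => cellB x y i
  | 3 => cellC x y i
  | 4 => cellD x y i
  | 5 => cell x y (i - 1) i

theorem two_le_card [Finite F] : 2 ≤ Nat.card F := Finite.one_lt_card

theorem mem_diagCell_iff [Finite F] (hu : u ≠ 0) (hv : v ≠ 0) (hi : 1 ≤ i)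
    {x y z : Matrix (Fin m) (Fin n) F} (hy : y - x = vecMulVec u v) {r s : ℕ} :
    z ∈ diagCell x y i r s ↔
      (label u v (z - x) = ⟨1, i⟩ ∧ 2 * Nat.card F ^ (i - 1) = r ∧ 0 = s) ∨
      (label u v (z - x) = ⟨2, i⟩ ∧ 2 * Nat.card F ^ (i - 1) - 1 = r ∧ 0 = s) ∨
      (label u v (z - x) = ⟨3, i⟩ ∧ Nat.card F ^ (i - 1) = r ∧ Nat.card F ^ m - Nat.card F ^ i = s) ∨
      (label u v (z - x) = ⟨4, i⟩ ∧ Nat.card F ^ (i - 1) = r ∧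
        Nat.card F ^ n - Nat.card F ^ i = s) := by
  rw [diagCell, Set.mem_ofPred_eq, mem_cell, ← sub_sub_sub_cancel_right z y x, hy,
    rank_pair_eq_iff hv, commonCount_eq hy, commonCount_eq hy]
  constructor
  · rintro ⟨h | h | h | h, h1, h2⟩
    · obtain ⟨h3, h4⟩ := ncard_commonSet_of_label_one hu hv hi h
      exact Or.inl ⟨h, by omega, by omega⟩
    · obtain ⟨h3, h4⟩ := ncard_commonSet_of_label_two hu hv hi h
      exact Or.inr (Or.inl ⟨h, by omega, by omega⟩)
    · obtain ⟨h3, h4⟩ := ncard_commonSet_of_label_three hu hv hi h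
      exact Or.inr (Or.inr (Or.inl ⟨h, by omega, by omega⟩))
    · obtain ⟨h3, h4⟩ := ncard_commonSet_of_label_four hu hv hi h
      exact Or.inr (Or.inr (Or.inr ⟨h, by omega, by omega⟩))
  · rintro (⟨h, rfl, rfl⟩ | ⟨h, rfl, rfl⟩ | ⟨h, rfl, rfl⟩ | ⟨h, rfl, rfl⟩)
    · exact ⟨Or.inl h, ncard_commonSet_of_label_one hu hv hi h⟩
    · exact ⟨Or.inr (Or.inl h), ncard_commonSet_of_label_two hu hv hi h⟩
    · exact ⟨Or.inr (Or.inr (Or.inl h)), ncard_commonSet_of_label_three hu hv hi h⟩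
    · exact ⟨Or.inr (Or.inr (Or.inr h)), ncard_commonSet_of_label_four hu hv hi h⟩

/-- The four pairs of counts are distinct. The first entries of B and C (or D) agree only when
`q^(i-1) = 1`, that is `i = 1`, and then the second entry is positive for C and D because `2 ≤ m`. C
and D differ in the second entry because `m < n`. -/
theorem mem_cellOfLabel_iff [Finite F] (hm : 2 ≤ m) (hmn : m < n) (hu : u ≠ 0) (hv : v ≠ 0)
    {x y z : Matrix (Fin m) (Fin n) F} (hy : y - x = vecMulVec u v) {k : Fin 6}
    (hk : (⟨k, i⟩ : (_ : Fin 6) × ℕ) ∈ labels m) :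
    z ∈ cellOfLabel x y k i ↔ label u v (z - x) = ⟨k, i⟩ := by
  have hq := two_le_card (F := F)
  have hik : lowIndex k ≤ i ∧ i ≤ highIndex m k := by simpa [labels] using hk
  have hi : 1 ≤ i := by
    unfold lowIndex at hik
    split_ifs at hik <;> omega
  have him : i ≤ m := by
    unfold highIndex at hik
    split_ifs at hik <;> omega
  have hQ : 1 ≤ Nat.card F ^ (i - 1) := Nat.one_le_pow _ _ (by omega)
  have hQ1 : Nat.card F ^ (i - 1) = 1 → i = 1 := by
    intro h
    have := (Nat.pow_eq_one.1 h).resolve_left (by omega)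
    omega
  have hlt : ∀ {a b : ℕ}, a < b → Nat.card F ^ a < Nat.card F ^ b :=
    fun h => Nat.pow_lt_pow_right (by omega) h
  have hmn' := hlt hmn
  have hile : Nat.card F ^ i ≤ Nat.card F ^ m := Nat.pow_le_pow_right (by omega) him
  have h1m : i = 1 → Nat.card F ^ i < Nat.card F ^ m := fun h => hlt (by omega)
  have hzy : (z - y).rank = ((z - x) - vecMulVec u v).rank := by
    rw [← hy, sub_sub_sub_cancel_right]
  fin_cases k
  · change z ∈ cell x y i (i - 1) ↔ label u v (z - x) = ⟨0, i⟩
    rw [mem_cell, hzy, rank_pair_eq_pred_iff hv hi]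
  · change z ∈ cellA x y i ↔ label u v (z - x) = ⟨1, i⟩
    rw [cellA, mem_diagCell_iff hu hv hi hy]
    refine ⟨?_, fun h => Or.inl ⟨h, rfl, rfl⟩⟩
    rintro (⟨h, -⟩ | ⟨-, h1, h2⟩ | ⟨-, h1, h2⟩ | ⟨-, h1, h2⟩)
    · exact h
    all_goals omega
  · change z ∈ cellB x y i ↔ label u v (z - x) = ⟨2, i⟩
    rw [cellB, mem_diagCell_iff hu hv hi hy]
    refine ⟨?_, fun h => Or.inr (Or.inl ⟨h, rfl, rfl⟩)⟩
    rintro (⟨-, h1, h2⟩ | ⟨h, -⟩ | ⟨-, h1, h2⟩ | ⟨-, h1, h2⟩)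
    · omega
    · exact h
    · have := h1m (hQ1 (by omega))
      omega
    · have := h1m (hQ1 (by omega))
      omega
  · change z ∈ cellC x y i ↔ label u v (z - x) = ⟨3, i⟩
    rw [cellC, mem_diagCell_iff hu hv hi hy]
    refine ⟨?_, fun h => Or.inr (Or.inr (Or.inl ⟨h, rfl, rfl⟩))⟩
    rintro (⟨-, h1, h2⟩ | ⟨-, h1, h2⟩ | ⟨h, -⟩ | ⟨-, h1, h2⟩)
    · omega
    · have := h1m (hQ1 (by omega))
      omega
    · exact h
    · omega
  · change z ∈ cellD x y i ↔ label u v (z - x) = ⟨4, i⟩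
    rw [cellD, mem_diagCell_iff hu hv hi hy]
    refine ⟨?_, fun h => Or.inr (Or.inr (Or.inr ⟨h, rfl, rfl⟩))⟩
    rintro (⟨-, h1, h2⟩ | ⟨-, h1, h2⟩ | ⟨-, h1, h2⟩ | ⟨h, -⟩)
    · omega
    · have := h1m (hQ1 (by omega))
      omega
    · omega
    · exact h
  · change z ∈ cell x y (i - 1) i ↔ label u v (z - x) = ⟨5, i⟩
    rw [mem_cell, hzy, rank_pair_eq_succ_iff hv hi]

/-- The `(x, y)`-partition consists of the fibres of `label`. -/
theorem xyPartition_eq_image [Finite F] (hm : 2 ≤ m) (hmn : m < n) (hu : u ≠ 0) (hv : v ≠ 0)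
    {x y : Matrix (Fin m) (Fin n) F} (hy : y - x = vecMulVec u v) :
    xyPartition x y = (fun l => {z | label u v (z - x) = l}) '' (labels m : Set _) := by
  have key : ∀ {k i}, (⟨k, i⟩ : (_ : Fin 6) × ℕ) ∈ labels m →
      cellOfLabel x y k i = {z | label u v (z - x) = ⟨k, i⟩} := fun hk =>
    Set.ext fun z => mem_cellOfLabel_iff hm hmn hu hv hy hk
  have hl : ∀ {k i}, (⟨k, i⟩ : (_ : Fin 6) × ℕ) ∈ labels m ↔
      lowIndex k ≤ i ∧ i ≤ highIndex m k := by simp [labels]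
  ext S
  constructor
  · rintro (⟨i, h1, h2, rfl⟩ | ⟨i, h1, h2, rfl⟩ | ⟨i, h1, h2, rfl⟩ | ⟨i, h1, h2, rfl⟩ |
      ⟨i, h1, h2, rfl⟩ | ⟨i, h1, h2, rfl⟩)
    · exact ⟨⟨0, i⟩, hl.2 ⟨h1, h2⟩, (key (hl.2 ⟨h1, h2⟩)).symm⟩
    · exact ⟨⟨1, i⟩, hl.2 ⟨h1, h2⟩, (key (hl.2 ⟨h1, h2⟩)).symm⟩
    · exact ⟨⟨2, i⟩, hl.2 ⟨h1, h2⟩, (key (hl.2 ⟨h1, h2⟩)).symm⟩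
    · exact ⟨⟨3, i⟩, hl.2 ⟨h1, h2⟩, (key (hl.2 ⟨h1, h2⟩)).symm⟩
    · exact ⟨⟨4, i⟩, hl.2 ⟨h1, h2⟩, (key (hl.2 ⟨h1, h2⟩)).symm⟩
    · exact ⟨⟨5, i⟩, hl.2 ⟨h1, h2⟩, (key (hl.2 ⟨h1, h2⟩)).symm⟩
  · rintro ⟨⟨k, i⟩, hk, rfl⟩
    simp only
    rw [← key hk]
    obtain ⟨h1, h2⟩ := hl.1 hk
    fin_cases k
    · exact Or.inl ⟨i, h1, h2, rfl⟩
    · exact Or.inr (Or.inl ⟨i, h1, h2, rfl⟩)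
    · exact Or.inr (Or.inr (Or.inl ⟨i, h1, h2, rfl⟩))
    · exact Or.inr (Or.inr (Or.inr (Or.inl ⟨i, h1, h2, rfl⟩)))
    · exact Or.inr (Or.inr (Or.inr (Or.inr (Or.inl ⟨i, h1, h2, rfl⟩))))
    · exact Or.inr (Or.inr (Or.inr (Or.inr (Or.inr ⟨i, h1, h2, rfl⟩))))

end CommonCount

/-! ### Every label occurs. -/

section Existence

variable {u : Fin m → F} {v : Fin n → F} {i : ℕ}

/-- The matrix with the identity of size `i` in the upper left corner and zeros elsewhere. -/
def partialId (F : Type*) [Field F] (m n i : ℕ) : Matrix (Fin m) (Fin n) F :=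
  Matrix.of fun a b => if a.val = b.val ∧ a.val < i then 1 else 0

theorem partialId_mulVec_apply {a : Fin m} {b : Fin n} (hab : a.val = b.val) (x : Fin n → F) :
    (partialId F m n i *ᵥ x) a = if a.val < i then x b else 0 := by
  rw [mulVec, dotProduct, Finset.sum_eq_single b]
  · simp [partialId, hab]
  · intro b' _ hb'
    have : a.val ≠ b'.val := fun h => hb' (Fin.ext (by omega))
    simp [partialId, this]
  · simp

theorem partialId_mulVec_single {a : Fin m} {b : Fin n} (hab : a.val = b.val) (hi : a.val < i) :
    partialId F m n i *ᵥ Pi.single b 1 = Pi.single a 1 := by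
  ext a'
  rw [mulVec_single_one]
  by_cases h : a' = a
  · subst h
    simp only [partialId, col_apply, of_apply, Pi.single_eq_same, ← hab, hi, true_and, if_true]
  · have : a'.val ≠ b.val := fun h' => h (Fin.ext (by omega))
    simp [partialId, h, this]

theorem partialId_mulVec_single_of_le {b : Fin n} (hi : i ≤ b.val) :
    partialId F m n i *ᵥ Pi.single b 1 = 0 := by
  ext a'
  rw [mulVec_single_one]
  have : ¬ (a'.val = b.val ∧ a'.val < i) := by omega
  simp [partialId, this]

theorem inRow_partialId {a : Fin m} {b : Fin n} (hab : a.val = b.val) (hi : a.val < i) :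
    InRow (partialId F m n i) (Pi.single b 1) := by
  intro x hx
  have := congrFun hx a
  rw [partialId_mulVec_apply hab, if_pos hi] at this
  simpa using this

theorem not_inRow_partialId {b : Fin n} (hi : i ≤ b.val) :
    ¬ InRow (partialId F m n i) (Pi.single b 1) := by
  intro h
  have := h _ (partialId_mulVec_single_of_le hi)
  simp at this

theorem not_inCol_partialId {a : Fin m} {b : Fin n} (hab : a.val = b.val) (hi : i ≤ a.val) :
    ¬ InCol (partialId F m n i) (Pi.single a 1) := by
  rintro ⟨x, hx⟩
  have := congrFun hx a
  rw [partialId_mulVec_apply hab, if_neg (by omega)] at this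
  simp at this

theorem rank_partialId (hm : i ≤ m) (hn : i ≤ n) : (partialId F m n i).rank = i := by
  induction i with
  | zero =>
    rw [rank_eq_zero_iff]
    ext a b
    simp [partialId]
  | succ i ih =>
    let a : Fin m := ⟨i, hm⟩
    let b : Fin n := ⟨i, hn⟩
    have hab : a.val = b.val := rfl
    have h := (rank_sub_add_one_eq_iff (M := partialId F m n (i + 1))
      (u := Pi.single a 1) (v := Pi.single b 1) (by simp)).2
      ⟨inRow_partialId hab (Nat.lt_succ_self i), _,
        partialId_mulVec_single hab (Nat.lt_succ_self i), by simp⟩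
    have hE : partialId F m n (i + 1) - vecMulVec (Pi.single a 1) (Pi.single b 1) =
        partialId F m n i := by
      ext a' b'
      simp only [partialId, Matrix.sub_apply, of_apply, vecMulVec_apply, Pi.single_apply, Fin.ext_iff, a, b]
      split_ifs <;> first | omega | simp
    rw [hE, ih (by omega) (by omega)] at h
    exact h.symm

theorem label_mul_mul {A : Matrix (Fin m) (Fin m) F} {B : Matrix (Fin n) (Fin n) F}
    (hA : IsUnit A.det) (hB : IsUnit B.det) (M : Matrix (Fin m) (Fin n) F) :
    label (A *ᵥ u) (v ᵥ* B) (A * M * B) = label u v M := by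
  rw [label, label, rank_mul_mul hA hB, propext (inRow_mul_mul hA hB),
    propext (inCol_mul_mul hA hB), propext (pairs_mul_mul hA hB (c := 1)),
    propext (pairs_mul_mul hA hB (c := 0))]

theorem not_inCol_zero (hu : u ≠ 0) : ¬ InCol (0 : Matrix (Fin m) (Fin n) F) u := fun h =>
  absurd (one_le_rank_of_inCol hu h) (by simp)

theorem not_inRow_zero (hv : v ≠ 0) : ¬ InRow (0 : Matrix (Fin m) (Fin n) F) v := fun h =>
  absurd (one_le_rank_of_inRow hv h) (by simp)

/-- The equivalence theorem applied to the zero matrix shows that pairs of nonzero vectors form a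
single orbit, so labels may be realised with convenient `u` and `v`. -/
theorem exists_label_eq_of_exists (hu : u ≠ 0) (hv : v ≠ 0) {u' : Fin m → F} {v' : Fin n → F}
    (hu' : u' ≠ 0) (hv' : v' ≠ 0) (M : Matrix (Fin m) (Fin n) F) :
    ∃ M', label u v M' = label u' v' M := by
  obtain ⟨A, B, hA, hB, -, rfl, rfl⟩ := exists_mul_mul_eq (M := (0 : Matrix (Fin m) (Fin n) F))
    (M' := 0) hu' hu hv' hv rfl (iff_of_false (not_inCol_zero hu') (not_inCol_zero hu))
    (iff_of_false (not_inRow_zero hv') (not_inRow_zero hv))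
    (fun h => absurd h (not_inRow_zero hv'))
  exact ⟨A * M * B, label_mul_mul hA hB M⟩

/-- Every label occurs. -/
theorem exists_label_eq (hm : 2 ≤ m) (hmn : m < n) (hF : ∃ c : F, c ≠ 0 ∧ c ≠ 1) (hu : u ≠ 0)
    (hv : v ≠ 0) {l : (_ : Fin 6) × ℕ} (hl : l ∈ labels m) :
    ∃ M : Matrix (Fin m) (Fin n) F, label u v M = l := by
  obtain ⟨k, i⟩ := l
  have hik : lowIndex k ≤ i ∧ i ≤ highIndex m k := by simpa [labels] using hl
  suffices H : ∃ (u' : Fin m → F) (v' : Fin n → F), u' ≠ 0 ∧ v' ≠ 0 ∧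
      ∃ M : Matrix (Fin m) (Fin n) F, label u' v' M = ⟨k, i⟩ by
    obtain ⟨u', v', hu', hv', M, hM⟩ := H
    obtain ⟨M', hM'⟩ := exists_label_eq_of_exists hu hv hu' hv' M
    exact ⟨M', hM'.trans hM⟩
  have hs : ∀ {d : ℕ} (a : Fin d), (Pi.single a 1 : Fin d → F) ≠ 0 := by simp
  let a0 : Fin m := ⟨0, by omega⟩
  let b0 : Fin n := ⟨0, by omega⟩
  have h00 : a0.val = b0.val := rfl
  fin_cases k
  · obtain ⟨h1, h2⟩ : 1 ≤ i ∧ i ≤ m := hik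
    refine ⟨_, _, hs a0, hs b0, partialId F m n i, label_eq_zero_iff.2
      ⟨inRow_partialId h00 h1, ⟨_, partialId_mulVec_single h00 h1, by simp⟩,
        rank_partialId h2 (by omega)⟩⟩
  · obtain ⟨h1, h2⟩ : 2 ≤ i ∧ i ≤ m := hik
    let a1 : Fin m := ⟨1, by omega⟩
    let b1 : Fin n := ⟨1, by omega⟩
    have h11 : a1.val = b1.val := rfl
    -- Distinct unit vectors inside the identity block, available since `i ≥ 2`, pair to zero.
    refine ⟨_, _, hs a0, hs b1, partialId F m n i, label_eq_one_iff.2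
      ⟨inRow_partialId h11 h1, ⟨_, partialId_mulVec_single h00 (show 0 < i by omega), ?_⟩,
        rank_partialId h2 (by omega)⟩⟩
    simp [b0, b1]
  · obtain ⟨h1, h2⟩ : 1 ≤ i ∧ i ≤ m := hik
    obtain ⟨c, hc0, hc1⟩ := hF
    have hR := inRow_partialId (F := F) h00 h1
    -- Scaling `u` by `c` scales the pairing value from 1 to `c`.
    have hP : Pairs (partialId F m n i) (c • Pi.single a0 1) (Pi.single b0 1) c :=
      ⟨c • Pi.single b0 1, by rw [mulVec_smul, partialId_mulVec_single h00 h1],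
        by rw [dotProduct_smul]; simp⟩
    exact ⟨_, _, smul_ne_zero hc0 (hs a0), hs b0, partialId F m n i, label_eq_two_iff.2
      ⟨hR, hP.inCol, fun h => hc1 (hR.pairs_unique hP h), fun h => hc0 (hR.pairs_unique hP h),
        rank_partialId h2 (by omega)⟩⟩
  · obtain ⟨h1, h2⟩ : 1 ≤ i ∧ i ≤ m := hik
    -- The first column outside the identity block; it exists even for `i = m` because `m < n`.
    let b : Fin n := ⟨i, by omega⟩
    exact ⟨_, _, hs a0, hs b, partialId F m n i, label_eq_three_iff.2
      ⟨not_inRow_partialId (le_refl i), ⟨_, partialId_mulVec_single h00 h1⟩,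
        rank_partialId h2 (by omega)⟩⟩
  · obtain ⟨h1, h2⟩ : 1 ≤ i ∧ i ≤ m - 1 := hik
    let a : Fin m := ⟨i, by omega⟩
    let b : Fin n := ⟨i, by omega⟩
    have hab : a.val = b.val := rfl
    exact ⟨_, _, hs a, hs b0, partialId F m n i, label_eq_four_iff.2
      ⟨inRow_partialId h00 h1, not_inCol_partialId hab (le_refl i),
        rank_partialId (by omega) (by omega)⟩⟩
  · obtain ⟨h1, h2⟩ : 1 ≤ i ∧ i ≤ m := hik
    let a : Fin m := ⟨i - 1, by omega⟩
    let b : Fin n := ⟨i - 1, by omega⟩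
    have hab : a.val = b.val := rfl
    refine ⟨_, _, hs a, hs b, partialId F m n (i - 1), label_eq_five_iff.2
      ⟨not_inRow_partialId (le_refl (i - 1)), not_inCol_partialId hab (le_refl (i - 1)), ?_⟩⟩
    rw [rank_partialId (by omega) (by omega)]
    omega

end Existence

/-! ### Neighbour counts: orbits and the balance argument. -/

/-- The number of neighbours of `M` in `T`. -/
noncomputable def nbrCount (M : Matrix (Fin m) (Fin n) F) (T : Set (Matrix (Fin m) (Fin n) F)) : ℕ :=
  {K | (M - K).rank = 1 ∧ K ∈ T}.ncard

section Transport

variable {u : Fin m → F} {v : Fin n → F} {M M' : Matrix (Fin m) (Fin n) F}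

theorem nbrCount_mul_mul {A : Matrix (Fin m) (Fin m) F} {B : Matrix (Fin n) (Fin n) F}
    (hA : IsUnit A.det) (hB : IsUnit B.det) (M : Matrix (Fin m) (Fin n) F)
    {T T' : Set (Matrix (Fin m) (Fin n) F)} (hT : ∀ K, A * K * B ∈ T' ↔ K ∈ T) :
    nbrCount (A * M * B) T' = nbrCount M T := by
  have hbij := mul_mul_bijective (m := m) (n := n) hA hB
  have h : {K | (A * M * B - K).rank = 1 ∧ K ∈ T'} =
      (fun K => A * K * B) '' {K | (M - K).rank = 1 ∧ K ∈ T} := by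
    have hr : ∀ K, (A * M * B - A * K * B).rank = (M - K).rank := by
      intro K
      rw [← Matrix.sub_mul, ← Matrix.mul_sub, rank_mul_mul hA hB]
    ext K
    constructor
    · rintro ⟨h1, h2⟩
      obtain ⟨K, rfl⟩ := hbij.2 K
      exact ⟨K, ⟨(hr K).symm.trans h1, (hT K).1 h2⟩, rfl⟩
    · rintro ⟨K, ⟨h1, h2⟩, rfl⟩
      exact ⟨(hr K).trans h1, (hT K).2 h2⟩
  rw [nbrCount, h, Set.ncard_image_of_injective _ hbij.1, nbrCount]

/-- For kinds other than 2 the label fixes every invariant, including the pairing value when there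
is one. For kind 2 that value can vary. -/
theorem exists_mul_mul_eq_of_label_eq (hu : u ≠ 0) (hv : v ≠ 0)
    (h : label u v M = label u v M') (h2 : (label u v M).1 ≠ 2) :
    ∃ (A : Matrix (Fin m) (Fin m) F) (B : Matrix (Fin n) (Fin n) F), IsUnit A.det ∧ IsUnit B.det ∧
      A * M * B = M' ∧ A *ᵥ u = u ∧ v ᵥ* B = v := by
  obtain ⟨⟨k, i⟩, hl⟩ : ∃ l, label u v M = l := ⟨_, rfl⟩
  rw [hl] at h h2
  have h' := h.symm
  fin_cases k
  · obtain ⟨a1, a2, a3⟩ := label_eq_zero_iff.1 hl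
    obtain ⟨b1, b2, b3⟩ := label_eq_zero_iff.1 h'
    exact exists_mul_mul_eq hu hu hv hv (a3.trans b3.symm) (iff_of_true a2.inCol b2.inCol)
      (iff_of_true a1 b1) fun _ c c' hc hc' =>
        (a1.pairs_unique hc a2).trans (b1.pairs_unique b2 hc')
  · obtain ⟨a1, a2, a3⟩ := label_eq_one_iff.1 hl
    obtain ⟨b1, b2, b3⟩ := label_eq_one_iff.1 h'
    exact exists_mul_mul_eq hu hu hv hv (a3.trans b3.symm) (iff_of_true a2.inCol b2.inCol)
      (iff_of_true a1 b1) fun _ c c' hc hc' =>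
        (a1.pairs_unique hc a2).trans (b1.pairs_unique b2 hc')
  · exact absurd rfl h2
  · obtain ⟨a1, a2, a3⟩ := label_eq_three_iff.1 hl
    obtain ⟨b1, b2, b3⟩ := label_eq_three_iff.1 h'
    exact exists_mul_mul_eq hu hu hv hv (a3.trans b3.symm) (iff_of_true a2 b2)
      (iff_of_false a1 b1) fun hR => absurd hR a1
  · obtain ⟨a1, a2, a3⟩ := label_eq_four_iff.1 hl
    obtain ⟨b1, b2, b3⟩ := label_eq_four_iff.1 h'
    exact exists_mul_mul_eq hu hu hv hv (a3.trans b3.symm) (iff_of_false a2 b2)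
      (iff_of_true a1 b1) fun _ c c' hc => absurd hc.inCol a2
  · obtain ⟨a1, a2, a3⟩ := label_eq_five_iff.1 hl
    obtain ⟨b1, b2, b3⟩ := label_eq_five_iff.1 h'
    exact exists_mul_mul_eq hu hu hv hv (by omega) (iff_of_false a2 b2)
      (iff_of_false a1 b1) fun hR => absurd hR a1

theorem nbrCount_eq_of_label_ne_two (hu : u ≠ 0) (hv : v ≠ 0)
    (h : label u v M = label u v M') (h2 : (label u v M).1 ≠ 2) (l : (_ : Fin 6) × ℕ) :
    nbrCount M {K | label u v K = l} = nbrCount M' {K | label u v K = l} := by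
  obtain ⟨A, B, hA, hB, rfl, hAu, hBv⟩ := exists_mul_mul_eq_of_label_eq hu hv h h2
  refine (nbrCount_mul_mul hA hB M fun K => ?_).symm
  have := label_mul_mul hA hB (u := u) (v := v) K
  rw [hAu, hBv] at this
  simp only [Set.mem_ofPred_eq, this]

theorem inCol_smul {t : F} (ht : t ≠ 0) : InCol M (t • u) ↔ InCol M u := by
  constructor
  · rintro ⟨x, hx⟩
    exact ⟨t⁻¹ • x, by rw [mulVec_smul, hx, smul_smul, inv_mul_cancel₀ ht, one_smul]⟩
  · rintro ⟨x, rfl⟩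
    exact ⟨t • x, mulVec_smul _ _ _⟩

theorem pairs_smul {t c : F} (ht : t ≠ 0) : Pairs M (t • u) v (t * c) ↔ Pairs M u v c := by
  constructor
  · rintro ⟨x, hx, hc⟩
    refine ⟨t⁻¹ • x, by rw [mulVec_smul, hx, smul_smul, inv_mul_cancel₀ ht, one_smul], ?_⟩
    rw [dotProduct_smul, hc, smul_eq_mul, inv_mul_cancel_left₀ ht]
  · rintro ⟨x, rfl, rfl⟩
    exact ⟨t • x, mulVec_smul _ _ _, dotProduct_smul _ _ _⟩

/-- Scaling `u` multiplies the pairing value by `t`. This respects the value 0 and may only mix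
value 1 with the other nonzero values, hence the exclusion of kinds 0 and 2. -/
theorem label_smul_eq_iff {t : F} (ht : t ≠ 0) {k : Fin 6} (hk0 : k ≠ 0) (hk2 : k ≠ 2) (j : ℕ) :
    label (t • u) v M = ⟨k, j⟩ ↔ label u v M = ⟨k, j⟩ := by
  have h0 : Pairs M (t • u) v 0 ↔ Pairs M u v 0 := by
    simpa using pairs_smul (M := M) (u := u) (v := v) (c := 0) ht
  fin_cases k
  · exact absurd rfl hk0
  · exact label_eq_one_iff.trans (Iff.trans (by rw [h0]) label_eq_one_iff.symm)
  · exact absurd rfl hk2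
  · exact label_eq_three_iff.trans (Iff.trans (by rw [inCol_smul ht]) label_eq_three_iff.symm)
  · exact label_eq_four_iff.trans (Iff.trans (by rw [inCol_smul ht]) label_eq_four_iff.symm)
  · exact label_eq_five_iff.trans (Iff.trans (by rw [inCol_smul ht]) label_eq_five_iff.symm)

theorem label_eq_zero_or_two_iff {j : ℕ} :
    (label u v M = ⟨0, j⟩ ∨ label u v M = ⟨2, j⟩) ↔
      InRow M v ∧ InCol M u ∧ ¬ Pairs M u v 0 ∧ M.rank = j := by
  rw [label_eq_zero_iff, label_eq_two_iff]
  constructor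
  · rintro (⟨h1, h2, h3⟩ | ⟨h1, h2, -, h3, h4⟩)
    · exact ⟨h1, h2.inCol, fun h => one_ne_zero (h1.pairs_unique h2 h), h3⟩
    · exact ⟨h1, h2, h3, h4⟩
  · rintro ⟨h1, h2, h3, h4⟩
    by_cases h : Pairs M u v 1
    · exact Or.inl ⟨h1, h, h4⟩
    · exact Or.inr ⟨h1, h2, h, h3, h4⟩

theorem exists_mul_mul_eq_of_label_two {i : ℕ} (hu : u ≠ 0) (hv : v ≠ 0)
    (h : label u v M = ⟨2, i⟩) (h' : label u v M' = ⟨2, i⟩) :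
    ∃ (A : Matrix (Fin m) (Fin m) F) (B : Matrix (Fin n) (Fin n) F) (t : F), t ≠ 0 ∧
      IsUnit A.det ∧ IsUnit B.det ∧ A * M * B = M' ∧ A *ᵥ u = t • u ∧ v ᵥ* B = v := by
  obtain ⟨a1, a2, -, a3, a4⟩ := label_eq_two_iff.1 h
  obtain ⟨b1, b2, -, b3, b4⟩ := label_eq_two_iff.1 h'
  obtain ⟨c, hc⟩ := a2.exists_pairs v
  obtain ⟨c', hc'⟩ := b2.exists_pairs v
  have hc0 : c ≠ 0 := by
    rintro rfl
    exact a3 hc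
  have hc0' : c' ≠ 0 := by
    rintro rfl
    exact b3 hc'
  -- Replacing `u` by `(c / c') • u` turns the pairing value of `M'` from `c'` into `c`.
  have ht : c / c' ≠ 0 := div_ne_zero hc0 hc0'
  have hct : Pairs M' ((c / c') • u) v c := by
    have := (pairs_smul ht).2 hc'
    rwa [div_mul_cancel₀ _ hc0'] at this
  obtain ⟨A, B, hA, hB, hM, hAu, hBv⟩ := exists_mul_mul_eq hu (smul_ne_zero ht hu) hv hv
    (a4.trans b4.symm) (iff_of_true a2 hct.inCol) (iff_of_true a1 b1)
    fun _ d d' hd hd' => (a1.pairs_unique hd hc).trans (b1.pairs_unique hct hd')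
  exact ⟨A, B, _, ht, hA, hB, hM, hAu, hBv⟩

theorem nbrCount_eq_of_label_two {i j : ℕ} (hu : u ≠ 0) (hv : v ≠ 0)
    (h : label u v M = ⟨2, i⟩) (h' : label u v M' = ⟨2, i⟩) {k : Fin 6} (hk0 : k ≠ 0)
    (hk2 : k ≠ 2) :
    nbrCount M {K | label u v K = ⟨k, j⟩} = nbrCount M' {K | label u v K = ⟨k, j⟩} := by
  obtain ⟨A, B, t, ht, hA, hB, rfl, hAu, hBv⟩ := exists_mul_mul_eq_of_label_two hu hv h h'
  refine (nbrCount_mul_mul hA hB M fun K => ?_).symm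
  have := label_mul_mul hA hB (u := u) (v := v) K
  rw [hAu, hBv] at this
  rw [Set.mem_ofPred_eq, Set.mem_ofPred_eq, ← this, label_smul_eq_iff ht hk0 hk2]

theorem nbrCount_zero_or_two_eq_of_label_two {i j : ℕ} (hu : u ≠ 0) (hv : v ≠ 0)
    (h : label u v M = ⟨2, i⟩) (h' : label u v M' = ⟨2, i⟩) :
    nbrCount M {K | label u v K = ⟨0, j⟩ ∨ label u v K = ⟨2, j⟩} =
      nbrCount M' {K | label u v K = ⟨0, j⟩ ∨ label u v K = ⟨2, j⟩} := by
  obtain ⟨A, B, t, ht, hA, hB, rfl, hAu, hBv⟩ := exists_mul_mul_eq_of_label_two hu hv h h'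
  refine (nbrCount_mul_mul hA hB M fun K => ?_).symm
  have := label_mul_mul hA hB (u := u) (v := v) K
  rw [hAu, hBv] at this
  have h0 : Pairs (A * K * B) (t • u) v 0 ↔ Pairs (A * K * B) u v 0 := by
    simpa using pairs_smul (M := A * K * B) (u := u) (v := v) (c := 0) ht
  rw [Set.mem_ofPred_eq, Set.mem_ofPred_eq, ← this, label_eq_zero_or_two_iff,
    label_eq_zero_or_two_iff, inCol_smul ht, h0]

/-- Rank reduction supplies markings with pairing value 1 on both sides, so their invariants agree.
-/
theorem exists_mul_mul_eq_of_rank_eq (h : M.rank = M'.rank) :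
    ∃ (A : Matrix (Fin m) (Fin m) F) (B : Matrix (Fin n) (Fin n) F), IsUnit A.det ∧ IsUnit B.det ∧
      A * M * B = M' := by
  by_cases hM : M = 0
  · subst hM
    obtain rfl : M' = 0 := by rw [← rank_eq_zero_iff, ← h, rank_zero]
    exact ⟨1, 1, by simp, by simp, by simp⟩
  · have hM' : M' ≠ 0 := by
      rintro rfl
      exact hM (by rw [← rank_eq_zero_iff, h, rank_zero])
    obtain ⟨a, b, ha, hb, hab⟩ := exists_rank_sub_add_one hM
    obtain ⟨a', b', ha', hb', hab'⟩ := exists_rank_sub_add_one hM'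
    obtain ⟨hR, hP⟩ := (rank_sub_add_one_eq_iff hb).1 hab
    obtain ⟨hR', hP'⟩ := (rank_sub_add_one_eq_iff hb').1 hab'
    obtain ⟨A, B, hA, hB, hE, -, -⟩ := exists_mul_mul_eq ha ha' hb hb' h
      (iff_of_true hP.inCol hP'.inCol) (iff_of_true hR hR')
      fun _ c c' hc hc' => (hR.pairs_unique hc hP).trans (hR'.pairs_unique hP' hc')
    exact ⟨A, B, hA, hB, hE⟩

theorem nbrCount_rank_eq (h : M.rank = M'.rank) (k : ℕ) :
    nbrCount M {K | K.rank = k} = nbrCount M' {K | K.rank = k} := by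
  obtain ⟨A, B, hA, hB, rfl⟩ := exists_mul_mul_eq_of_rank_eq h
  refine (nbrCount_mul_mul hA hB M fun K => ?_).symm
  rw [Set.mem_ofPred_eq, Set.mem_ofPred_eq, rank_mul_mul hA hB]

theorem nbrCount_sub (M L : Matrix (Fin m) (Fin n) F) (T : Set (Matrix (Fin m) (Fin n) F)) :
    nbrCount (M - L) T = nbrCount M {K | K - L ∈ T} := by
  have h : {K | (M - L - K).rank = 1 ∧ K ∈ T} =
      (fun K => K - L) '' {K | (M - K).rank = 1 ∧ K - L ∈ T} := by
    ext K
    constructor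
    · rintro ⟨h1, h2⟩
      refine ⟨K + L, ⟨?_, by simpa using h2⟩, by simp⟩
      rw [← h1]
      congr 1
      abel
    · rintro ⟨K, ⟨h1, h2⟩, rfl⟩
      exact ⟨by rwa [sub_sub_sub_cancel_right], h2⟩
  rw [nbrCount, h, Set.ncard_image_of_injective _ (sub_left_injective), nbrCount]
  rfl

theorem nbrCount_eq_add [Finite F] {T T₁ T₂ : Set (Matrix (Fin m) (Fin n) F)}
    (h : ∀ K, (M - K).rank = 1 → (K ∈ T ↔ K ∈ T₁ ∨ K ∈ T₂)) (hd : ∀ K ∈ T₁, K ∉ T₂) :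
    nbrCount M T = nbrCount M T₁ + nbrCount M T₂ := by
  have hE : {K | (M - K).rank = 1 ∧ K ∈ T} =
      {K | (M - K).rank = 1 ∧ K ∈ T₁} ∪ {K | (M - K).rank = 1 ∧ K ∈ T₂} := by
    ext K
    have := h K
    simp only [Set.mem_ofPred_eq, Set.mem_union]
    tauto
  rw [nbrCount, hE, Set.ncard_union_eq _ (Set.toFinite _) (Set.toFinite _), nbrCount, nbrCount]
  exact Set.disjoint_left.2 fun K h1 h2 => hd K h1.2 h2.2

theorem nbrCount_eq_zero {T : Set (Matrix (Fin m) (Fin n) F)}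
    (h : ∀ K, (M - K).rank = 1 → K ∉ T) : nbrCount M T = 0 := by
  have : {K | (M - K).rank = 1 ∧ K ∈ T} = ∅ :=
    Set.eq_empty_iff_forall_notMem.2 fun K hK => h K hK.1 hK.2
  rw [nbrCount, this, Set.ncard_empty]

/-- A vertex at the same distance from two adjacent vertices has equally many neighbours in
`O_{j,j-1}` and in `O_{j-1,j}`. -/
theorem nbrCount_zero_eq_nbrCount_five [Finite F] {i j : ℕ} (hu : u ≠ 0) (hv : v ≠ 0)
    (hj : 1 ≤ j) (hM : M.rank = i) (hM' : (M - vecMulVec u v).rank = i) :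
    nbrCount M {K | label u v K = ⟨0, j⟩} = nbrCount M {K | label u v K = ⟨5, j⟩} := by
  simp only [← rank_pair_eq_pred_iff hv hj, ← rank_pair_eq_succ_iff hv hj]
  have key : ∀ K, (M - K).rank = 1 → i ≤ K.rank + 1 ∧ K.rank ≤ i + 1 ∧
      i ≤ (K - vecMulVec u v).rank + 1 ∧ (K - vecMulVec u v).rank ≤ i + 1 ∧
      K.rank ≤ (K - vecMulVec u v).rank + 1 ∧ (K - vecMulVec u v).rank ≤ K.rank + 1 := by
    intro K hK
    have hK' : (K - M).rank = 1 := by rwa [rank_sub_comm]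
    have h1 := rank_le_rank_add_one hK
    have h2 := rank_le_rank_add_one hK'
    rw [← sub_sub_sub_cancel_right _ _ (vecMulVec u v)] at hK hK'
    have h3 := rank_le_rank_add_one hK
    have h4 := rank_le_rank_add_one hK'
    have h5 : (K - (K - vecMulVec u v)).rank = 1 := by
      rw [sub_sub_cancel, rank_vecMulVec_eq_one hu hv]
    have h6 := rank_le_rank_add_one h5
    rw [rank_sub_comm] at h5
    have h7 := rank_le_rank_add_one h5
    omega
  -- `M` and `M - vecMulVec u v` have equal rank and so are equivalent: `M` has as many neighbours
  -- at distance `k` from `0` as from `vecMulVec u v`.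
  have hdeg : ∀ k, nbrCount M {K | K.rank = k} =
      nbrCount M {K | (K - vecMulVec u v).rank = k} := by
    intro k
    rw [nbrCount_rank_eq (hM.trans hM'.symm) k, nbrCount_sub]
    rfl
  -- A neighbour at distance `k = i ± 1` from one base point is at distance `k` or `i` from the
  -- other; those at distance `k` from both cancel. Stating `k + 1 = i` avoids truncation at `i =
  -- 0`.
  have hsum : ∀ k, (k + 1 = i ∨ k = i + 1) →
      nbrCount M {K | K.rank = k ∧ (K - vecMulVec u v).rank = i} =
        nbrCount M {K | K.rank = i ∧ (K - vecMulVec u v).rank = k} := by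
    intro k hk
    have h1 : nbrCount M {K | K.rank = k} =
        nbrCount M {K | K.rank = k ∧ (K - vecMulVec u v).rank = k} +
          nbrCount M {K | K.rank = k ∧ (K - vecMulVec u v).rank = i} := by
      refine nbrCount_eq_add (fun K hK => ?_) fun K hK hK' => ?_
      · have := key K hK
        simp only [Set.mem_ofPred_eq]
        omega
      · simp only [Set.mem_ofPred_eq] at hK hK'
        omega
    have h2 : nbrCount M {K | (K - vecMulVec u v).rank = k} =
        nbrCount M {K | K.rank = k ∧ (K - vecMulVec u v).rank = k} +
          nbrCount M {K | K.rank = i ∧ (K - vecMulVec u v).rank = k} := by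
      refine nbrCount_eq_add (fun K hK => ?_) fun K hK hK' => ?_
      · have := key K hK
        simp only [Set.mem_ofPred_eq]
        omega
      · simp only [Set.mem_ofPred_eq] at hK hK'
        omega
    have h3 := hdeg k
    omega
  by_cases h1 : j = i
  · subst h1
    exact (hsum (j - 1) (by omega)).symm
  · by_cases h2 : j = i + 1
    · subst h2
      exact hsum (i + 1) (by omega)
    · rw [nbrCount_eq_zero, nbrCount_eq_zero]
      · intro K hK hK'
        have := key K hK
        simp only [Set.mem_ofPred_eq] at hK'
        omega
      · intro K hK hK'
        have := key K hK
        simp only [Set.mem_ofPred_eq] at hK'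
        omega

/-- The number of neighbours of `M` in a cell depends only on the cell of `M`. -/
theorem nbrCount_eq_of_label_eq [Finite F] (hu : u ≠ 0) (hv : v ≠ 0)
    (h : label u v M = label u v M') {l : (_ : Fin 6) × ℕ} (hl : 1 ≤ l.2) :
    nbrCount M {K | label u v K = l} = nbrCount M' {K | label u v K = l} := by
  obtain ⟨⟨k', i⟩, hi⟩ : ∃ l, label u v M = l := ⟨_, rfl⟩
  by_cases hk' : k' = 2
  · subst hk'
    obtain ⟨k, j⟩ := l
    have hi' : label u v M' = ⟨2, i⟩ := h.symm.trans hi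
    -- Balance trades kind 0 for kind 5, which scaling of `u` respects.
    have h0 : nbrCount M {K | label u v K = ⟨0, j⟩} = nbrCount M' {K | label u v K = ⟨0, j⟩} := by
      obtain ⟨h1, h2⟩ := (rank_pair_eq_iff hv).2 (Or.inr (Or.inl hi))
      obtain ⟨h1', h2'⟩ := (rank_pair_eq_iff hv).2 (Or.inr (Or.inl hi'))
      rw [nbrCount_zero_eq_nbrCount_five hu hv hl h1 h2,
        nbrCount_zero_eq_nbrCount_five hu hv hl h1' h2']
      exact nbrCount_eq_of_label_two hu hv hi hi' (by decide) (by decide)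
    by_cases hk0 : k = 0
    · subst hk0
      exact h0
    · by_cases hk2 : k = 2
      · subst hk2
        -- The count for kind 2 is what remains of the scaling-stable union once kind 0 is known.
        have hsum : ∀ M, nbrCount M {K | label u v K = ⟨0, j⟩ ∨ label u v K = ⟨2, j⟩} =
            nbrCount M {K | label u v K = ⟨0, j⟩} + nbrCount M {K | label u v K = ⟨2, j⟩} := by
          intro M
          refine nbrCount_eq_add (fun K _ => Iff.rfl) fun K hK hK' => ?_
          simp only [Set.mem_ofPred_eq] at hK hK'
          rw [hK] at hK'
          simp at hK'
        have h02 := nbrCount_zero_or_two_eq_of_label_two (j := j) hu hv hi hi'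
        rw [hsum, hsum] at h02
        omega
      · exact nbrCount_eq_of_label_two hu hv hi hi' hk0 hk2
  · exact nbrCount_eq_of_label_ne_two hu hv h (by rwa [hi]) l

end Transport

/-! ### Conclusion. -/

theorem exists_ne_zero_ne_one [Finite F] (hq : Nat.card F ≠ 2) : ∃ c : F, c ≠ 0 ∧ c ≠ 1 := by
  by_contra hc
  push Not at hc
  apply hq
  have : (Set.univ : Set F) = {0, 1} := by
    ext c
    simp only [Set.mem_univ, Set.mem_insert_iff, Set.mem_singleton_iff, true_iff]
    exact or_iff_not_imp_left.2 (hc c)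
  rw [← Set.ncard_univ, this, Set.ncard_pair zero_ne_one]

end BilinearForms

theorem proposition7p8 {F : Type*} [Field F] [Finite F] (hq : Nat.card F ≠ 2) (D N : ℕ)
    (hD : 6 ≤ 2 * D) (hN : 2 * D < N) (x y : Matrix (Fin D) (Fin (N - D)) F)
    (hxy : (bilinearFormsGraph F D (N - D)).Adj x y) :
    (BilinearForms.xyPartition x y).ncard = 6 * D - 2 ∧
      (bilinearFormsGraph F D (N - D)).IsEquitablePartition (BilinearForms.xyPartition x y) := by
  obtain ⟨u, v, hu, hv, hy⟩ := BilinearForms.exists_eq_vecMulVec (M := y - x)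
    ((BilinearForms.rank_sub_comm y x).trans hxy)
  have hex : ∀ l ∈ BilinearForms.labels D, ∃ z, BilinearForms.label u v (z - x) = l := by
    intro l hl
    obtain ⟨M, hM⟩ := BilinearForms.exists_label_eq (n := N - D) (by omega) (by omega)
      (BilinearForms.exists_ne_zero_ne_one hq) hu hv hl
    exact ⟨M + x, by rwa [add_sub_cancel_right]⟩
  rw [BilinearForms.xyPartition_eq_image (by omega) (by omega) hu hv hy]
  refine ⟨?_, ⟨?_, fun z => ?_⟩, ?_⟩
  · rw [Set.InjOn.ncard_image, Set.ncard_coe_finset, BilinearForms.card_labels (by omega)]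
    -- Equal fibres share a vertex because they are nonempty, and that vertex has only one label.
    intro l hl l' _ hll
    obtain ⟨z, hz⟩ := hex l hl
    have hz' : z ∈ {z | BilinearForms.label u v (z - x) = l'} := (Set.ext_iff.1 hll z).1 hz
    exact hz.symm.trans hz'
  · rintro ⟨l, hl, h⟩
    obtain ⟨z, hz⟩ := hex l hl
    exact (h ▸ hz : z ∈ (∅ : Set _))
  · refine ⟨{w | BilinearForms.label u v (w - x) = BilinearForms.label u v (z - x)},
      ⟨⟨_, BilinearForms.label_mem_labels hu hv, rfl⟩, rfl⟩, ?_⟩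
    rintro _ ⟨⟨l, -, rfl⟩, rfl⟩
    rfl
  · rintro _ ⟨l, hl, rfl⟩ _ ⟨l', hl', rfl⟩
    have hnbr : ∀ z, ((bilinearFormsGraph F D (N - D)).neighborSet z ∩
        {w | BilinearForms.label u v (w - x) = l'}).ncard =
        BilinearForms.nbrCount (z - x) {K | BilinearForms.label u v K = l'} := by
      intro z
      rw [BilinearForms.nbrCount_sub]
      rfl
    have hl1 : 1 ≤ l'.2 := by
      simp only [BilinearForms.labels, Finset.coe_sigma, Set.mem_sigma_iff, Finset.coe_Icc,
        Set.mem_Icc, BilinearForms.lowIndex] at hl'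
      have := hl'.2.1
      split_ifs at this <;> omega
    obtain ⟨z₀, hz₀⟩ := hex l hl
    refine ⟨BilinearForms.nbrCount (z₀ - x) {K | BilinearForms.label u v K = l'},
      fun z hz => (hnbr z).trans ?_⟩
    exact BilinearForms.nbrCount_eq_of_label_eq hu hv (M' := z₀ - x)
      (Eq.trans hz hz₀.symm) hl1
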